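/- **Setting.** Fix $n$ and a finite family $\mathcal P$ of feasible subsets of $\{1,\dots,n\}$. In the *pen testing environment*, pen $i$ holds an unknown amount of ink $v_i\ge 0$, the $v_i$ being independent with $v_i\sim F_i$. Writing with pen $i$ for time $\theta\ge 0$ succeeds if its current ink level $u_i$ (initially $v_i$) is at least $\theta$, and then $u_i$ becomes $u_i-\theta$; otherwise the test fails and $u_i$ becomes $0$. Only success or failure is observed. A pen testing algorithm (adaptive, possibly randomized, knowing the $F_i$) makes tests, then stops and outputs some $P\in\mathcal P$; its performance is $\mathbb E[\sum_{i\in P}u_i]$. The *standard benchmark* is the supremum of the performances of pen testing algorithms; the *omniscient benchmark* is $\mathbb E[\max_{S\in\mathcal P}\sum_{i\in S}v_i]$. In the *analogous auction environment* the $v_i$ are the agents' values; the expected optimal surplus is $\mathbb E[\max_{S\in\mathcal P}\sum_{i\in S}v_i]$, and the expected optimal consumer surplus is the supremum of (expected value of the served agents minus expected payments) over Bayesian incentive compatible, individually rational mechanisms that serve feasible sets and have nonnegative payments. A (possibly randomized) *deferred-acceptance auction* proceeds in stages, starting with all agents active and all prices $0$. It stops as soon as the active set is feasible, and then serves the active agents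 at their current prices. Otherwise it offers each agent a new price in $[0,\infty]$, no lower than the previous one and depending on the history of active sets, and active agents whose value is below their new price drop out. A *deferred-acceptance mechanism* $\mathrm{DA}$ specifies such an auction for every product distribution of values; for every product distribution with finite means its auction stops almost surely. For a distribution function $F$, let $v(q)=\inf\{x\ge 0: F(x)\ge 1-q\}$, $V(q)=\int_0^q v(t)\,dt$ and $U(q)=V(q)-q\,v(q)$ for $q\in[0,1]$, let $\overline U$ be the concave hull of $U$ on $[0,1]$ and $\bar u=\overline U'$ the ironed virtual value. The *virtual-pricing transformation* of $\mathrm{DA}$ at $F_1,\dots,F_n$ runs the auction that $\mathrm{DA}$ specifies for the distributions of the ironed virtual values $\bar u_i(q_i)$, $q_i$ uniform on $[0,1]$, and whenever this auction offers agent $i$ a price $r$, it offers the price $v_i(\theta_i)$ with $\theta_i=\sup\{\theta\in[0,1]:\bar u_i(\theta)\ge r\}$ (and $\theta_i=0$ if the set is empty). The pen testing algorithm of a deferred-acceptance auction tests, at each stage, every active pen up to the price offered (by the increment of its price), drops the pens whose test fails, and outputs the active set when the auction stops. **Theorem 1.** Let $\mathrm{DA}$ be a deferred-acceptance mechanism.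 Let $\gamma\in[0,\infty]$ be its standard approximation, i.e. the supremum, over all product distributions with finite means, of the ratio of the expected optimal surplus to the expected surplus (total value of the served agents) of $\mathrm{DA}$. Let $\zeta\in[0,\infty]$ be the optimal omniscient approximation, i.e. the supremum, over all product distributions with finite means and no atoms, of the ratio of the omniscient benchmark to the expected optimal consumer surplus. (Ratios are taken in $[0,\infty]$, with $0/0=0$.) Let $F_1,\dots,F_n$ be atomless distributions on $[0,\infty)$ with finite means. Then the pen testing algorithm of the virtual-pricing transformation of $\mathrm{DA}$ at $F_1,\dots,F_n$ almost surely stops with a feasible set, the ratio of the standard benchmark to its performance is at most $\gamma$, and the ratio of the omniscient benchmark to its performance is at most $\gamma\,\zeta$. -/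

import Mathlib

open MeasureTheory Set
open scoped NNReal ENNReal

noncomputable section

namespace PenTesting

/-! ## Values, ink levels and the surplus benchmark

An environment is a number `n` of pens (agents) and a finite family `Feas` of feasible subsets of
`Fin n`.  Values (ink levels) are nonnegative reals; a product prior is a family
`F : Fin n → ProbabilityMeasure ℝ≥0`. -/

/-- The mean of the distribution is finite. -/
def FiniteMean (F : ProbabilityMeasure ℝ≥0) : Prop :=
  ∫⁻ x, (x : ℝ≥0∞) ∂(F : Measure ℝ≥0) ≠ ∞

/-- The distribution has no atoms, i.e. its distribution function is continuous. -/
def Atomless (F : ProbabilityMeasure ℝ≥0) : Prop :=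
  ∀ x : ℝ≥0, (F : Measure ℝ≥0) {x} = 0

/-- The joint law of independent values. -/
def productLaw {n : ℕ} (F : Fin n → ProbabilityMeasure ℝ≥0) : Measure (Fin n → ℝ≥0) :=
  Measure.pi fun i => (F i : Measure ℝ≥0)

/-- The expected optimal surplus `𝔼 [max_{S feasible} ∑_{i ∈ S} v i]`.  For pens, this is the
omniscient benchmark. -/
def optSurplus {n : ℕ} (Feas : Finset (Finset (Fin n))) (F : Fin n → ProbabilityMeasure ℝ≥0) :
    ℝ≥0∞ :=
  ∫⁻ v, Feas.sup (fun S => ∑ i ∈ S, (v i : ℝ≥0∞)) ∂(productLaw F)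

/-! ## Pen testing algorithms -/

/-- One step of an algorithm: write with pen `i` for time `θ`, or stop and output a set.  Writing
for time `∞` just empties the pen. -/
inductive PenAction (n : ℕ) : Type
  | test (i : Fin n) (θ : ℝ≥0∞)
  | output (P : Finset (Fin n))

/-- A randomized adaptive pen testing algorithm: a seed is drawn, and the next action depends on
the seed and on the signals received so far (most recent first). -/
structure PenAlg (n : ℕ) : Type 1 where
  Seed : Type
  [measurableSeed : MeasurableSpace Seed]
  seedLaw : Measure Seed
  [isProb : IsProbabilityMeasure seedLaw]
  strategy : Seed → List Bool → PenAction n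
  measurable_test : ∀ (h : List Bool) (i : Fin n) (s : Set ℝ≥0∞), MeasurableSet s →
    MeasurableSet {ω | ∃ θ ∈ s, strategy ω h = PenAction.test i θ}
  measurable_output : ∀ (h : List Bool) (P : Finset (Fin n)),
    MeasurableSet {ω | strategy ω h = PenAction.output P}

attribute [instance] PenAlg.measurableSeed PenAlg.isProb

namespace PenAlg

variable {n : ℕ} (alg : PenAlg n)

/-- One step on (residual ink levels, signals).  A test `(i, θ)` succeeds iff `θ ≤ u i`; subtraction
in `ℝ≥0∞` is truncated, so that `u i - θ` is the new ink level whether or not the test succeeds.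
Nothing changes once the algorithm has stopped. -/
def step (ω : alg.Seed) (s : (Fin n → ℝ≥0∞) × List Bool) : (Fin n → ℝ≥0∞) × List Bool :=
  match alg.strategy ω s.2 with
  | PenAction.test i θ => (Function.update s.1 i (s.1 i - θ), decide (θ ≤ s.1 i) :: s.2)
  | PenAction.output _ => s

/-- The residual ink levels and the signals after `t` steps. -/
def run (ω : alg.Seed) (v : Fin n → ℝ≥0) (t : ℕ) : (Fin n → ℝ≥0∞) × List Bool :=
  (alg.step ω)^[t] (fun i => (v i : ℝ≥0∞), [])

/-- The residual ink in the output if the algorithm has stopped within `t` steps, else `0`. -/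
def payoffAt (ω : alg.Seed) (v : Fin n → ℝ≥0) (t : ℕ) : ℝ≥0∞ :=
  match alg.strategy ω (alg.run ω v t).2 with
  | PenAction.test _ _ => 0
  | PenAction.output P => ∑ i ∈ P, (alg.run ω v t).1 i

/-- The residual ink in the output; `payoffAt` is constant from the stopping time on. -/
def payoff (ω : alg.Seed) (v : Fin n → ℝ≥0) : ℝ≥0∞ := ⨆ t, alg.payoffAt ω v t

/-- The expected residual ink in the output. -/
def performance (F : Fin n → ProbabilityMeasure ℝ≥0) : ℝ≥0∞ :=
  ∫⁻ x, alg.payoff x.1 x.2 ∂(alg.seedLaw.prod (productLaw F))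

/-- Almost surely, the algorithm stops and outputs a feasible set. -/
def Valid (Feas : Finset (Finset (Fin n))) (F : Fin n → ProbabilityMeasure ℝ≥0) : Prop :=
  ∀ᵐ x ∂(alg.seedLaw.prod (productLaw F)),
    ∃ t, ∃ P ∈ Feas, alg.strategy x.1 (alg.run x.1 x.2 t).2 = PenAction.output P

end PenAlg

/-- The standard benchmark: the optimal expected performance of a pen testing algorithm (which may
depend on the prior). -/
def standardBenchmark {n : ℕ} (Feas : Finset (Finset (Fin n)))
    (F : Fin n → ProbabilityMeasure ℝ≥0) : ℝ≥0∞ :=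
  ⨆ (alg : PenAlg n) (_ : alg.Valid Feas F), alg.performance F

/-! ## Optimal consumer surplus -/

/-- A randomized direct mechanism: for each reported value profile, a probability distribution on
the feasible sets, and nonnegative payments. -/
structure Mechanism (n : ℕ) (Feas : Finset (Finset (Fin n))) where
  alloc : (Fin n → ℝ≥0) → Finset (Fin n) → ℝ≥0
  alloc_sum : ∀ v, ∑ S ∈ Feas, alloc v S = 1
  measurable_alloc : ∀ S ∈ Feas, Measurable fun v => alloc v S
  pay : Fin n → (Fin n → ℝ≥0) → ℝ≥0
  measurable_pay : ∀ i, Measurable (pay i)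

namespace Mechanism

variable {n : ℕ} {Feas : Finset (Finset (Fin n))} (M : Mechanism n Feas)

/-- The probability that agent `i` is served at the reports `v`. -/
def serve (i : Fin n) (v : Fin n → ℝ≥0) : ℝ≥0 :=
  ∑ S ∈ Feas with i ∈ S, M.alloc v S

/-- Interim allocation of agent `i` who reports `b`. -/
def interimServe (F : Fin n → ProbabilityMeasure ℝ≥0) (i : Fin n) (b : ℝ≥0) : ℝ≥0∞ :=
  ∫⁻ v, (M.serve i (Function.update v i b) : ℝ≥0∞) ∂(productLaw F)

/-- Interim payment of agent `i` who reports `b`. -/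
def interimPay (F : Fin n → ProbabilityMeasure ℝ≥0) (i : Fin n) (b : ℝ≥0) : ℝ≥0∞ :=
  ∫⁻ v, (M.pay i (Function.update v i b) : ℝ≥0∞) ∂(productLaw F)

/-- Bayesian incentive compatibility, `x a - p(a) ≥ a x(b) - p(b)` in interim terms, written without
subtraction. -/
def IsBIC (F : Fin n → ProbabilityMeasure ℝ≥0) : Prop :=
  ∀ (i : Fin n) (a b : ℝ≥0),
    (a : ℝ≥0∞) * M.interimServe F i b + M.interimPay F i a ≤
      (a : ℝ≥0∞) * M.interimServe F i a + M.interimPay F i b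

/-- Interim individual rationality. -/
def IsIR (F : Fin n → ProbabilityMeasure ℝ≥0) : Prop :=
  ∀ (i : Fin n) (a : ℝ≥0), M.interimPay F i a ≤ (a : ℝ≥0∞) * M.interimServe F i a

/-- Expected surplus minus expected payments. -/
def consumerSurplus (F : Fin n → ProbabilityMeasure ℝ≥0) : ℝ≥0∞ :=
  (∫⁻ v, ∑ i, (v i : ℝ≥0∞) * (M.serve i v : ℝ≥0∞) ∂(productLaw F)) -
    ∫⁻ v, ∑ i, (M.pay i v : ℝ≥0∞) ∂(productLaw F)

end Mechanism

/-- The expected optimal consumer surplus, over all Bayesian incentive compatible and individually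
rational mechanisms. -/
def optConsumerSurplus {n : ℕ} (Feas : Finset (Finset (Fin n)))
    (F : Fin n → ProbabilityMeasure ℝ≥0) : ℝ≥0∞ :=
  ⨆ (M : Mechanism n Feas) (_ : M.IsBIC F ∧ M.IsIR F), M.consumerSurplus F

/-! ## Deferred-acceptance auctions -/

/-- A randomized deferred-acceptance (ascending-price) auction: a seed is drawn, and
`price ω A h i` is the price offered to agent `i` at the stage with active set `A`, where `h` lists
the active sets of the earlier stages, most recent first.  Prices never decrease along a history.
The price `∞` rejects an agent. -/
structure DAAuction (n : ℕ) : Type 1 where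
  Seed : Type
  [measurableSeed : MeasurableSpace Seed]
  seedLaw : Measure Seed
  [isProb : IsProbabilityMeasure seedLaw]
  price : Seed → Finset (Fin n) → List (Finset (Fin n)) → Fin n → ℝ≥0∞
  measurable_price : ∀ A h i, Measurable fun ω => price ω A h i
  price_mono : ∀ ω A B h i, A ⊆ B → price ω B h i ≤ price ω A (B :: h) i

attribute [instance] DAAuction.measurableSeed DAAuction.isProb

namespace DAAuction

variable {n : ℕ} (D : DAAuction n) (Feas : Finset (Finset (Fin n)))

/-- One stage on (active set, earlier active sets).  The auction stops when the active set is
feasible; otherwise new prices are offered and an active agent stays iff the price is at most its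
value. -/
def step (ω : D.Seed) (v : Fin n → ℝ≥0) (s : Finset (Fin n) × List (Finset (Fin n))) :
    Finset (Fin n) × List (Finset (Fin n)) :=
  open Classical in
  if s.1 ∈ Feas then s
  else (s.1.filter fun i => D.price ω s.1 s.2 i ≤ (v i : ℝ≥0∞), s.1 :: s.2)

/-- The active set and the history after `t` stages; initially all agents are active. -/
def run (ω : D.Seed) (v : Fin n → ℝ≥0) (t : ℕ) : Finset (Fin n) × List (Finset (Fin n)) :=
  (D.step Feas ω v)^[t] (Finset.univ, [])

/-- The winners' total value if the auction has stopped within `t` stages, else `0`. -/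
def surplusAt (ω : D.Seed) (v : Fin n → ℝ≥0) (t : ℕ) : ℝ≥0∞ :=
  if (D.run Feas ω v t).1 ∈ Feas then ∑ i ∈ (D.run Feas ω v t).1, (v i : ℝ≥0∞) else 0

/-- The expected surplus: `surplusAt` is constant from the stage at which the auction stops. -/
def surplus (F : Fin n → ProbabilityMeasure ℝ≥0) : ℝ≥0∞ :=
  ∫⁻ x, ⨆ t, D.surplusAt Feas x.1 x.2 t ∂(D.seedLaw.prod (productLaw F))

/-- Almost surely, the auction stops (with a feasible active set). -/
def Terminates (F : Fin n → ProbabilityMeasure ℝ≥0) : Prop :=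
  ∀ᵐ x ∂(D.seedLaw.prod (productLaw F)), ∃ t, (D.run Feas x.1 x.2 t).1 ∈ Feas

/-- The standing prices, i.e. those offered at the previous stage (`0` at the first stage).  They
are charged to the winners when the auction stops. -/
def standing (ω : D.Seed) : List (Finset (Fin n)) → Fin n → ℝ≥0∞
  | [], _ => 0
  | A :: h, i => D.price ω A h i

end DAAuction

/-! ### The pen testing algorithm of a deferred-acceptance auction -/

/-- Bookkeeping for running an auction by tests: the active set and the earlier active sets, the
active pens still to be tested at this stage, and the pens that have passed at this stage. -/
structure ClockState (n : ℕ) where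
  current : Finset (Fin n)
  past : List (Finset (Fin n))
  pending : List (Fin n)
  staying : Finset (Fin n)

namespace ClockState

variable {n : ℕ} (Feas : Finset (Finset (Fin n)))

/-- The state at the start of a stage; nothing remains to be tested if the active set is feasible. -/
def enter (A : Finset (Fin n)) (past : List (Finset (Fin n))) : ClockState n :=
  ⟨A, past, if A ∈ Feas then [] else (List.finRange n).filter (fun i => i ∈ A), ∅⟩

/-- The effect of a signal for the first pending pen. -/
def update (b : Bool) (s : ClockState n) : ClockState n :=
  match s.pending with
  | [] => s
  | [i] => enter Feas (if b then insert i s.staying else s.staying) (s.current :: s.past)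
  | i :: j :: l => ⟨s.current, s.past, j :: l, if b then insert i s.staying else s.staying⟩

/-- The state after a list of signals (most recent first). -/
def replay (h : List Bool) : ClockState n :=
  h.foldr (update Feas) (enter Feas Finset.univ [])

end ClockState

namespace DAAuction

variable {n : ℕ} (D : DAAuction n) (Feas : Finset (Finset (Fin n)))

/-- At each stage, every active pen is tested up to the price offered by the auction, i.e. for the
increment of its price; when nothing remains to be tested, the active set is output. -/
def action (ω : D.Seed) (s : ClockState n) : PenAction n :=
  match s.pending with
  | [] => PenAction.output s.current
  | i :: _ => PenAction.test i (D.price ω s.current s.past i - D.standing ω s.past i)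

theorem measurable_standing (h : List (Finset (Fin n))) (i : Fin n) :
    Measurable fun ω => D.standing ω h i := by
  cases h with
  | nil => exact measurable_const
  | cons A h => exact D.measurable_price A h i

/-- The pen testing algorithm with thresholds equal to the prices of the auction. -/
def toPenAlg : PenAlg n where
  Seed := D.Seed
  seedLaw := D.seedLaw
  strategy ω h := D.action ω (ClockState.replay Feas h)
  measurable_test h i s hs := by
    unfold action
    cases (ClockState.replay Feas h).pending with
    | nil => simp
    | cons j l =>
      by_cases hij : j = i
      · subst hij
        have hm : Measurable fun ω => D.price ω (ClockState.replay Feas h).current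
            (ClockState.replay Feas h).past j -
              D.standing ω (ClockState.replay Feas h).past j :=
          (D.measurable_price _ _ _).sub (D.measurable_standing _ _)
        have he : {ω | ∃ θ ∈ s, PenAction.test j
            (D.price ω (ClockState.replay Feas h).current (ClockState.replay Feas h).past j -
              D.standing ω (ClockState.replay Feas h).past j) = PenAction.test j θ} =
            (fun ω => D.price ω (ClockState.replay Feas h).current
              (ClockState.replay Feas h).past j -
                D.standing ω (ClockState.replay Feas h).past j) ⁻¹' s := by
          ext ω
          simp
        exact he ▸ hm hs
      · simp [hij]
  measurable_output h P := by
    unfold action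
    cases (ClockState.replay Feas h).pending with
    | nil => simp
    | cons j l => simp

end DAAuction

/-! ## Ironed virtual values for consumer surplus -/

/-- The inverse demand function: the least value `x` with `F(x) ≥ 1 - q` (`∞` if there is none).
If `F` has no atoms, it satisfies `F(v(q)) = 1 - q`, and `v(1) = 0`. -/
def inverseDemand (F : ProbabilityMeasure ℝ≥0) (q : ℝ) : ℝ≥0∞ :=
  ⨅ (x : ℝ≥0) (_ : 1 - q ≤ (F : Measure ℝ≥0).real (Iic x)), (x : ℝ≥0∞)

/-- The price-posting surplus curve `V(q) = ∫₀^q v(t) dt`. -/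
def surplusCurve (F : ProbabilityMeasure ℝ≥0) (q : ℝ) : ℝ :=
  (∫⁻ t in Ioc 0 q, inverseDemand F t).toReal

/-- The price-posting consumer surplus curve `U(q) = V(q) - q v(q)`. -/
def consumerCurve (F : ProbabilityMeasure ℝ≥0) (q : ℝ) : ℝ :=
  surplusCurve F q - q * (inverseDemand F q).toReal

/-- The concave hull on `[0, 1]`: the least concave function above `U`. -/
def concaveHull (U : ℝ → ℝ) (q : ℝ) : ℝ :=
  sInf {y | ∃ g : ℝ → ℝ, ConcaveOn ℝ (Icc 0 1) g ∧ (∀ t ∈ Icc (0 : ℝ) 1, U t ≤ g t) ∧ g q = y}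

/-- The ironed virtual value at quantile `q`: the (right) derivative of the concave hull. -/
def ironedVirtual (F : ProbabilityMeasure ℝ≥0) (q : ℝ) : ℝ :=
  derivWithin (concaveHull (consumerCurve F)) (Ici q) q

theorem measurable_ironedVirtual (F : ProbabilityMeasure ℝ≥0) :
    Measurable fun q => (ironedVirtual F q).toNNReal :=
  (measurable_derivWithin_Ici _).real_toNNReal

/-- The distribution of the ironed virtual value, at a uniformly random quantile. -/
def ironedLaw (F : ProbabilityMeasure ℝ≥0) : ProbabilityMeasure ℝ≥0 :=
  ⟨(volume.restrict (Icc (0 : ℝ) 1)).map fun q => (ironedVirtual F q).toNNReal, by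
    have : IsProbabilityMeasure (volume.restrict (Icc (0 : ℝ) 1)) := ⟨by simp⟩
    exact Measure.isProbabilityMeasure_map (measurable_ironedVirtual F).aemeasurable⟩

/-- The price `v(θ)` that corresponds to the ironed virtual price `r`, where
`θ = sup {θ ∈ [0, 1] : ironed virtual value at θ is at least r}` (`0` if there is none). -/
def virtualPrice (F : ProbabilityMeasure ℝ≥0) (r : ℝ≥0∞) : ℝ≥0∞ :=
  inverseDemand F (sSup {θ | θ ∈ Icc (0 : ℝ) 1 ∧ r ≤ ENNReal.ofReal (ironedVirtual F θ)})

theorem inverseDemand_antitone (F : ProbabilityMeasure ℝ≥0) : Antitone (inverseDemand F) := by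
  intro q r hqr
  refine le_iInf₂ fun x hx => iInf₂_le x ?_
  linarith

theorem virtualPrice_monotone (F : ProbabilityMeasure ℝ≥0) : Monotone (virtualPrice F) := by
  intro r s hrs
  apply inverseDemand_antitone
  rcases Set.eq_empty_or_nonempty
    {θ | θ ∈ Icc (0 : ℝ) 1 ∧ s ≤ ENNReal.ofReal (ironedVirtual F θ)} with h | h
  · rw [h, Real.sSup_empty]
    exact Real.sSup_nonneg fun x hx => hx.1.1
  · exact csSup_le_csSup ⟨1, fun x hx => hx.1.2⟩ h fun x hx => ⟨hx.1, hrs.trans hx.2⟩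

/-- The virtual-pricing transformation of an auction, for values distributed by `F`: whenever the
auction offers the price `r` to agent `i`, the transformed auction offers the price corresponding to
the ironed virtual price `r`. -/
def DAAuction.virtualPricing {n : ℕ} (D : DAAuction n) (F : Fin n → ProbabilityMeasure ℝ≥0) :
    DAAuction n where
  Seed := D.Seed
  seedLaw := D.seedLaw
  price ω A h i := virtualPrice (F i) (D.price ω A h i)
  measurable_price A h i := (virtualPrice_monotone (F i)).measurable.comp (D.measurable_price A h i)
  price_mono ω A B h i hAB := virtualPrice_monotone (F i) (D.price_mono ω A B h i hAB)

/-! ## The approximation ratios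

Ratios are taken in `ℝ≥0∞`, where `0 / 0 = 0` and `a / 0 = ∞` for `a ≠ 0`. -/

/-- The standard approximation `γ` of a deferred-acceptance mechanism, which to every product prior
associates an auction: the worst-case ratio, over all product priors with finite means, of the
expected optimal surplus to the expected surplus of the auction. -/
def standardApprox {n : ℕ} (Feas : Finset (Finset (Fin n)))
    (DA : (Fin n → ProbabilityMeasure ℝ≥0) → DAAuction n) : ℝ≥0∞ :=
  ⨆ (G : Fin n → ProbabilityMeasure ℝ≥0) (_ : ∀ i, FiniteMean (G i)),
    optSurplus Feas G / (DA G).surplus Feas G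

/-- The optimal omniscient approximation `ζ`: the worst-case ratio, over all product priors with
finite means and no atoms, of the omniscient benchmark to the expected optimal consumer surplus. -/
def omniscientApprox {n : ℕ} (Feas : Finset (Finset (Fin n))) : ℝ≥0∞ :=
  ⨆ (F : Fin n → ProbabilityMeasure ℝ≥0)
    (_ : ∀ i, FiniteMean (F i) ∧ Atomless (F i)),
    optSurplus Feas F / optConsumerSurplus Feas F

end PenTesting

end

/-!
The proof compares every quantity with the optimal surplus `g` of the auction environment whose
values are the ironed virtual values, that is with `optSurplus Feas fun i => ironedLaw (F i)`.

*Single agents.*  Let `x` be a price, accepted by an atomless value with probability `θ`.  The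
expected utility `𝔼 (v - x)⁺` is at most `U(θ)`, with equality at `x = v(θ)`, and the expected
ironed virtual value of those who accept is `∫₀^θ Ū' = Ū(θ)`.  As `U ≤ Ū`, utility is at most
virtual surplus (`lintegral_sub_le_virtualValue`).  At the prices offered by the virtual-pricing
transformation `θ` is the end of an upper level set of `Ū'`; since `Ū` is affine around every point
where `U < Ū`, the two curves agree there and utility equals virtual surplus
(`virtualValue_eq_lintegral_sub_virtualPrice`).

*Pen testing algorithms.*  Fix the seed.  Given a history of signals, the residual ink of pen `i` is
`v i - s` with `s` the total time for which it was tested, and the history restricts `v i`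
independently of the other pens, to `v i ≥ s` or to values for which the pen is empty
(`consistent_section`).  So on every history the residual ink of an output pen is a utility from the
price `s`, hence is bounded by virtual surplus.  Summing over the countably many histories bounds
the standard benchmark by `g` (`standardBenchmark_le`).

*The transformed auction.*  Almost surely it runs at the values as the original auction runs at the
ironed virtual values (`ae_run_virtualPricing`), its tests follow its stages (`Reach.exists_run`),
and on each of its histories the price that a winner faces is one at which utility equals virtual
surplus.  So the performance of the algorithm is at least the surplus of the original auction for
the ironed virtual values (`surplus_ironedLaw_le`), which is at least `g / γ`.

*Consumer surplus.*  The utility of an incentive compatible mechanism is the integral of its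
monotone interim allocation rule (`envelope`).  Such a rule is a mixture of posted prices, so
consumer surplus is at most virtual surplus, and the optimal consumer surplus is at most `g`
(`optConsumerSurplus_le`).  Hence the omniscient benchmark is at most `ζ g`, and the second ratio is
the product of the two bounds.
-/

noncomputable section

namespace PenTesting

/-! ### The concave hull of a monotone curve -/

section Hull

variable {U : ℝ → ℝ}

theorem concaveHull_le {g : ℝ → ℝ} (hg : ConcaveOn ℝ (Icc 0 1) g)
    (hUg : ∀ t ∈ Icc (0 : ℝ) 1, U t ≤ g t) {q : ℝ} (hq : q ∈ Icc (0 : ℝ) 1) :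
    concaveHull U q ≤ g q :=
  csInf_le ⟨U q, by rintro y ⟨g, -, hg, rfl⟩; exact hg q hq⟩ ⟨g, hg, hUg, rfl⟩

theorem le_concaveHull_of_forall (hU : MonotoneOn U (Icc 0 1)) {q c : ℝ}
    (h : ∀ g : ℝ → ℝ, ConcaveOn ℝ (Icc 0 1) g → (∀ t ∈ Icc (0 : ℝ) 1, U t ≤ g t) → c ≤ g q) :
    c ≤ concaveHull U q := by
  refine le_csInf ⟨U 1, fun _ => U 1, concaveOn_const _ (convex_Icc 0 1), fun t ht => ?_, rfl⟩ ?_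
  · exact hU ht (right_mem_Icc.2 zero_le_one) ht.2
  · rintro y ⟨g, hg, hUg, rfl⟩
    exact h g hg hUg

theorem le_concaveHull (hU : MonotoneOn U (Icc 0 1)) {q : ℝ} (hq : q ∈ Icc (0 : ℝ) 1) :
    U q ≤ concaveHull U q :=
  le_concaveHull_of_forall hU fun _ _ hg => hg q hq

theorem concaveOn_concaveHull (hU : MonotoneOn U (Icc 0 1)) :
    ConcaveOn ℝ (Icc 0 1) (concaveHull U) := by
  refine ⟨convex_Icc 0 1, fun x hx y hy a b ha hb hab => ?_⟩
  refine le_concaveHull_of_forall hU fun g hg hUg => ?_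
  refine le_trans ?_ (hg.2 hx hy ha hb hab)
  simp only [smul_eq_mul]
  gcongr
  · exact concaveHull_le hg hUg hx
  · exact concaveHull_le hg hUg hy

theorem concaveHull_le_one (hU : MonotoneOn U (Icc 0 1)) {q : ℝ} (hq : q ∈ Icc (0 : ℝ) 1) :
    concaveHull U q ≤ U 1 :=
  concaveHull_le (g := fun _ => U 1) (concaveOn_const _ (convex_Icc 0 1))
    (fun _ ht => hU ht (right_mem_Icc.2 zero_le_one) ht.2) hq

theorem concaveHull_one (hU : MonotoneOn U (Icc 0 1)) : concaveHull U 1 = U 1 :=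
  le_antisymm (concaveHull_le_one hU (right_mem_Icc.2 zero_le_one))
    (le_concaveHull hU (right_mem_Icc.2 zero_le_one))

/-- A linear bound on the hull from a bound on the curve near `0`. -/
theorem concaveHull_le_add_mul (hU : MonotoneOn U (Icc 0 1)) (h0 : U 0 = 0) {δ ε : ℝ}
    (hδ : 0 < δ) (hδ1 : δ ≤ 1) (hε : 0 ≤ ε) (h : U δ ≤ ε) {q : ℝ} (hq : q ∈ Icc (0 : ℝ) 1) :
    concaveHull U q ≤ ε + U 1 / δ * q := by
  have h1 : 0 ≤ U 1 :=
    h0 ▸ hU (left_mem_Icc.2 zero_le_one) (right_mem_Icc.2 zero_le_one) zero_le_one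
  refine concaveHull_le (g := fun q => ε + U 1 / δ * q) ?_ (fun t ht => ?_) hq
  · refine ⟨convex_Icc 0 1, fun x _ y _ a b _ _ hab => le_of_eq ?_⟩
    simp only [smul_eq_mul]
    linear_combination ε * hab
  · rcases le_total t δ with htδ | htδ
    · have := hU ht ⟨hδ.le, hδ1⟩ htδ
      have : 0 ≤ U 1 / δ * t := mul_nonneg (by positivity) ht.1
      linarith
    · have h2 := hU ht (right_mem_Icc.2 zero_le_one) ht.2
      have : U 1 * 1 ≤ U 1 * (t / δ) := by gcongr; exact (one_le_div hδ).2 htδ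
      have h3 : U 1 / δ * t = U 1 * (t / δ) := by ring
      rw [h3]; linarith

/-- Here and below, `hrc` is the right continuity of the monotone curve on `[0, 1)`.  At `0` it
makes the linear bounds on the hull arbitrarily small. -/
theorem concaveHull_zero (hU : MonotoneOn U (Icc 0 1)) (h0 : U 0 = 0)
    (hrc : ∀ q ∈ Ico (0 : ℝ) 1, ∀ c, U q < c → ∃ b ∈ Ioo q 1, U b < c) :
    concaveHull U 0 = 0 := by
  refine le_antisymm (le_of_forall_pos_le_add fun ε hε => ?_)
    (h0.ge.trans (le_concaveHull hU (left_mem_Icc.2 zero_le_one)))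
  obtain ⟨b, hb, hUb⟩ := hrc 0 ⟨le_rfl, one_pos⟩ ε (h0.le.trans_lt hε)
  simpa using concaveHull_le_add_mul hU h0 hb.1 hb.2.le hε.le hUb.le (left_mem_Icc.2 zero_le_one)

theorem monotoneOn_concaveHull (hU : MonotoneOn U (Icc 0 1)) :
    MonotoneOn (concaveHull U) (Icc 0 1) := by
  intro x hx y hy hxy
  have h1 : (1 : ℝ) ∈ Icc (0 : ℝ) 1 := right_mem_Icc.2 zero_le_one
  -- `y` lies between `x` and `1`, where the hull has its maximum
  have hseg : y ∈ segment ℝ x 1 := by rw [segment_eq_Icc hx.2]; exact ⟨hxy, hy.2⟩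
  have := (concaveOn_concaveHull hU).ge_on_segment hx h1 hseg
  rwa [concaveHull_one hU, min_eq_left (concaveHull_le_one hU hx)] at this

theorem continuousOn_concaveHull (hU : MonotoneOn U (Icc 0 1)) (h0 : U 0 = 0)
    (hrc : ∀ q ∈ Ico (0 : ℝ) 1, ∀ c, U q < c → ∃ b ∈ Ioo q 1, U b < c) :
    ContinuousOn (concaveHull U) (Icc 0 1) := by
  have hc := concaveOn_concaveHull hU
  have hm := monotoneOn_concaveHull hU
  have hH0 := concaveHull_zero hU h0 hrc
  have hH1 := concaveHull_one hU
  have h01 : (0 : ℝ) ∈ Icc (0 : ℝ) 1 := left_mem_Icc.2 zero_le_one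
  have h11 : (1 : ℝ) ∈ Icc (0 : ℝ) 1 := right_mem_Icc.2 zero_le_one
  intro x hx
  rcases hx.1.eq_or_lt with rfl | hx0
  · rw [Metric.continuousWithinAt_iff]
    intro ε hε
    obtain ⟨b, hb, hUb⟩ := hrc 0 ⟨le_rfl, one_pos⟩ (ε / 2) (by rw [h0]; positivity)
    have hU1 : 0 ≤ U 1 := h0 ▸ hU h01 h11 zero_le_one
    refine ⟨ε / 2 / (U 1 / b + 1), by have := hb.1; positivity, fun {y} hy hy' => ?_⟩
    have hbd := concaveHull_le_add_mul hU h0 hb.1 hb.2.le (by positivity) hUb.le hy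
    have hK : 0 < U 1 / b + 1 := by have := hb.1; positivity
    rw [hH0, Real.dist_eq, sub_zero, abs_of_nonneg (hH0 ▸ hm h01 hy hy.1)]
    rw [Real.dist_eq, sub_zero, abs_of_nonneg hy.1, lt_div_iff₀ hK] at hy'
    have := hy.1
    nlinarith
  · rcases hx.2.eq_or_lt with rfl | hx1
    · have hlow : ∀ y ∈ Icc (0 : ℝ) 1, y * U 1 ≤ concaveHull U y := fun y hy => by
        have := hc.2 h01 h11 (sub_nonneg.2 hy.2) hy.1 (by ring)
        simpa [hH0, hH1] using this
      refine tendsto_of_tendsto_of_tendsto_of_le_of_le' (g := fun y => y * U 1)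
        (h := fun _ => U 1) ?_ ?_ ?_ ?_
      · rw [hH1]
        have : Continuous fun y : ℝ => y * U 1 := by fun_prop
        exact tendsto_nhdsWithin_of_tendsto_nhds (this.tendsto' 1 _ (one_mul _))
      · rw [hH1]; exact tendsto_const_nhds
      · filter_upwards [self_mem_nhdsWithin] with y hy using hlow y hy
      · filter_upwards [self_mem_nhdsWithin] with y hy using concaveHull_le_one hU hy
    · have hxi : x ∈ interior (Icc (0 : ℝ) 1) := by rw [interior_Icc]; exact ⟨hx0, hx1⟩
      exact ((hc.continuousOn_interior.continuousAt
        (isOpen_interior.mem_nhds hxi))).continuousWithinAt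

/-- At interior points the right derivative, which defines the ironed virtual value, exists. -/
theorem hasDerivWithinAt_concaveHull (hU : MonotoneOn U (Icc 0 1)) {q : ℝ}
    (hq : q ∈ Ioo (0 : ℝ) 1) :
    HasDerivWithinAt (concaveHull U) (derivWithin (concaveHull U) (Ici q) q) (Ioi q) q := by
  have h := (concaveOn_concaveHull hU).neg.hasDerivWithinAt_rightDeriv_of_mem_interior
    (by rw [interior_Icc]; exact hq)
  have h' : DifferentiableWithinAt ℝ (concaveHull U) (Ioi q) q := by
    simpa using h.differentiableWithinAt.neg
  rw [← derivWithin_Ioi_eq_Ici]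
  exact h'.hasDerivWithinAt

theorem antitoneOn_derivWithin_concaveHull (hU : MonotoneOn U (Icc 0 1)) :
    AntitoneOn (fun q => derivWithin (concaveHull U) (Ici q) q) (Ioo 0 1) := by
  have h := (concaveOn_concaveHull hU).neg.monotoneOn_rightDeriv
  rw [interior_Icc] at h
  intro x hx y hy hxy
  have := h hx hy hxy
  simp only [derivWithin.neg, neg_le_neg_iff, derivWithin_Ioi_eq_Ici] at this
  exact this

theorem derivWithin_concaveHull_nonneg (hU : MonotoneOn U (Icc 0 1)) {q : ℝ}
    (hq : q ∈ Ioo (0 : ℝ) 1) : 0 ≤ derivWithin (concaveHull U) (Ici q) q := by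
  have h1 : (1 : ℝ) ∈ Icc (0 : ℝ) 1 := right_mem_Icc.2 zero_le_one
  have hq' : q ∈ Icc (0 : ℝ) 1 := Ioo_subset_Icc_self hq
  refine le_trans ?_ ((concaveOn_concaveHull hU).slope_le_of_hasDerivWithinAt_Ioi hq' h1 hq.2
    (hasDerivWithinAt_concaveHull hU hq))
  rw [slope_def_field]
  exact div_nonneg (sub_nonneg.2 (monotoneOn_concaveHull hU hq' h1 hq.2.le))
    (sub_nonneg.2 hq.2.le)

/-- Beyond `1` no majorant is constrained, and the infimum of all reals is `0`. -/
theorem concaveHull_of_one_lt {q : ℝ} (hq : 1 < q) (hU : MonotoneOn U (Icc 0 1)) :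
    concaveHull U q = 0 := by
  have : {y | ∃ g : ℝ → ℝ, ConcaveOn ℝ (Icc 0 1) g ∧ (∀ t ∈ Icc (0 : ℝ) 1, U t ≤ g t) ∧ g q = y} =
      univ := by
    refine eq_univ_of_forall fun y => ⟨fun t => if t ≤ 1 then U 1 else y, ?_, ?_, ?_⟩
    · exact (concaveOn_const (U 1) (convex_Icc 0 1)).congr fun t ht => (if_pos ht.2).symm
    · intro t ht
      simp only [if_pos ht.2]
      exact hU ht (right_mem_Icc.2 zero_le_one) ht.2
    · simp [not_le.2 hq]
  unfold concaveHull
  rw [this, Real.sInf_univ]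

/-- The right derivative at `1` compares the hull with its junk value `0` beyond `1`. -/
theorem derivWithin_concaveHull_one_nonpos (hU : MonotoneOn U (Icc 0 1)) (h0 : U 0 = 0) :
    derivWithin (concaveHull U) (Ici 1) 1 ≤ 0 := by
  refine AntitoneOn.derivWithin_nonpos fun x hx y hy hxy => ?_
  rcases (mem_Ici.1 hy).eq_or_lt with rfl | hy1
  · rw [le_antisymm hxy hx]
  rw [concaveHull_of_one_lt hy1 hU]
  rcases (mem_Ici.1 hx).eq_or_lt with rfl | hx1
  · rw [concaveHull_one hU, ← h0]
    exact hU (left_mem_Icc.2 zero_le_one) (right_mem_Icc.2 zero_le_one) zero_le_one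
  · rw [concaveHull_of_one_lt hx1 hU]

/-- The endpoints, where the right derivative may be infinite or meaningless, are null. -/
theorem lintegral_derivWithin_concaveHull (hU : MonotoneOn U (Icc 0 1)) (h0 : U 0 = 0)
    (hrc : ∀ q ∈ Ico (0 : ℝ) 1, ∀ c, U q < c → ∃ b ∈ Ioo q 1, U b < c) {θ : ℝ}
    (hθ : θ ∈ Icc (0 : ℝ) 1) :
    ∫⁻ q in Icc 0 θ, ENNReal.ofReal (derivWithin (concaveHull U) (Ici q) q) =
      ENNReal.ofReal (concaveHull U θ) := by
  have hcont := (continuousOn_concaveHull hU h0 hrc).mono (Icc_subset_Icc_right hθ.2)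
  have hsub : ∀ x ∈ Ioo 0 θ, x ∈ Ioo (0 : ℝ) 1 := fun x hx => ⟨hx.1, hx.2.trans_le hθ.2⟩
  have hint := intervalIntegral.integrableOn_deriv_right_of_nonneg hcont
    (fun x hx => hasDerivWithinAt_concaveHull hU (hsub x hx))
    (fun x hx => derivWithin_concaveHull_nonneg hU (hsub x hx))
  have hftc := intervalIntegral.integral_eq_sub_of_hasDeriv_right_of_le hθ.1 hcont
    (fun x hx => hasDerivWithinAt_concaveHull hU (hsub x hx))
    ((intervalIntegrable_iff_integrableOn_Ioc_of_le hθ.1).2 hint)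
  rw [concaveHull_zero hU h0 hrc, sub_zero, intervalIntegral.integral_of_le hθ.1,
    integral_Ioc_eq_integral_Ioo] at hftc
  rw [← hftc, ofReal_integral_eq_lintegral_ofReal (hint.mono_set Ioo_subset_Ioc_self)]
  · exact setLIntegral_congr Ioo_ae_eq_Icc.symm
  · filter_upwards [ae_restrict_mem measurableSet_Ioo] with x hx
    exact derivWithin_concaveHull_nonneg hU (hsub x hx)

/-- Around an interior point where the curve lies strictly below its hull, the hull is affine. -/
theorem concaveHull_affine_of_lt (hU : MonotoneOn U (Icc 0 1)) (h0 : U 0 = 0)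
    (hrc : ∀ q ∈ Ico (0 : ℝ) 1, ∀ c, U q < c → ∃ b ∈ Ioo q 1, U b < c) {θ : ℝ}
    (hθ : θ ∈ Ioo (0 : ℝ) 1) (hlt : U θ < concaveHull U θ) :
    ∃ a b s c : ℝ, 0 < a ∧ a < θ ∧ θ < b ∧ b < 1 ∧
      ∀ t ∈ Icc a b, concaveHull U t = s * t + c := by
  have hc := concaveOn_concaveHull hU
  have hm := monotoneOn_concaveHull hU
  have hcont : ContinuousAt (concaveHull U) θ :=
    (continuousOn_concaveHull hU h0 hrc).continuousAt (Icc_mem_nhds hθ.1 hθ.2)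
  obtain ⟨b, hb, hUb⟩ := hrc θ ⟨hθ.1.le, hθ.2⟩ _ hlt
  obtain ⟨a, ha0, haθ, hab'⟩ : ∃ a, 0 < a ∧ a < θ ∧ U b < concaveHull U a := by
    have h1 : ∀ᶠ t in nhdsWithin θ (Iio θ), U b < concaveHull U t :=
      (hcont.tendsto.eventually_const_lt hUb).filter_mono nhdsWithin_le_nhds
    have h2 : ∀ᶠ t in nhdsWithin θ (Iio θ), t ∈ Ioo 0 θ := Ioo_mem_nhdsLT hθ.1
    obtain ⟨a, h3, h4⟩ := (h1.and h2).exists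
    exact ⟨a, h4.1, h4.2, h3⟩
  have hab : a < b := haθ.trans hb.1
  have haI : a ∈ Icc (0 : ℝ) 1 := ⟨ha0.le, (hab.trans hb.2).le⟩
  have hbI : b ∈ Icc (0 : ℝ) 1 := ⟨(ha0.trans hab).le, hb.2.le⟩
  set s := (concaveHull U b - concaveHull U a) / (b - a) with hs
  set L : ℝ → ℝ := fun t => s * t + (concaveHull U a - s * a) with hL
  have hsab : s * (b - a) = concaveHull U b - concaveHull U a :=
    div_mul_cancel₀ _ (sub_pos.2 hab).ne'
  have hs0 : 0 ≤ s := div_nonneg (sub_nonneg.2 (hm haI hbI hab.le)) (sub_pos.2 hab).le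
  -- outside `[a, b]` a concave function lies below its chord
  have hout : ∀ t ∈ Icc (0 : ℝ) 1, t ≤ a ∨ b ≤ t → concaveHull U t ≤ L t := by
    rintro t ht (hta | hbt)
    · rcases hta.eq_or_lt with rfl | hta
      · simp [hL]
      · have := hc.slope_anti_adjacent ht hbI hta hab
        rw [← hs, le_div_iff₀ (sub_pos.2 hta)] at this
        simp only [hL]; linarith
    · rcases hbt.eq_or_lt with rfl | hbt
      · simp only [hL]; linarith
      · have := hc.slope_anti_adjacent haI ht hab hbt
        rw [← hs, div_le_iff₀ (sub_pos.2 hbt)] at this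
        simp only [hL]; linarith
  have hin : ∀ t ∈ Icc a b, L t ≤ concaveHull U t := by
    intro t ht
    rcases ht.1.eq_or_lt with rfl | hat
    · simp [hL]
    rcases ht.2.eq_or_lt with rfl | htb
    · simp only [hL]; linarith
    have := hc.slope_anti_adjacent haI hbI hat htb
    rw [div_le_div_iff₀ (sub_pos.2 htb) (sub_pos.2 hat)] at this
    have h2 : (b - a) * L t ≤ (b - a) * concaveHull U t := by
      simp only [hL]
      have : (b - a) * (s * t + (concaveHull U a - s * a)) =
        (s * (b - a)) * (t - a) + (b - a) * concaveHull U a := by ring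
      rw [this, hsab]; linarith
    exact le_of_mul_le_mul_left h2 (sub_pos.2 hab)
  have hLc : ConcaveOn ℝ (Icc 0 1) L := by
    refine ⟨convex_Icc 0 1, fun x _ y _ p r _ _ hpr => le_of_eq ?_⟩
    simp only [smul_eq_mul, hL]
    linear_combination (concaveHull U a - s * a) * hpr
  -- inside, `U ≤ U b ≤ concaveHull U a ≤ L`, by the choice of `a` and `b`
  have hUL : ∀ t ∈ Icc (0 : ℝ) 1, U t ≤ L t := by
    intro t ht
    by_cases h : t ≤ a ∨ b ≤ t
    · exact (le_concaveHull hU ht).trans (hout t ht h)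
    · push Not at h
      refine (hU ht hbI h.2.le).trans (hab'.le.trans ?_)
      simp only [hL]
      nlinarith [mul_nonneg hs0 (sub_nonneg.2 h.1.le)]
  refine ⟨a, b, s, concaveHull U a - s * a, ha0, haθ, hb.1, hb.2, fun t ht => ?_⟩
  exact le_antisymm (concaveHull_le hLc hUL ⟨ha0.le.trans ht.1, ht.2.trans hb.2.le⟩) (hin t ht)

/-- The curve touches its hull at the upper end of an upper level set of the hull's derivative. -/
theorem concaveHull_eq_at_sSup (hU : MonotoneOn U (Icc 0 1)) (h0 : U 0 = 0)
    (hrc : ∀ q ∈ Ico (0 : ℝ) 1, ∀ c, U q < c → ∃ b ∈ Ioo q 1, U b < c) (r : ℝ≥0∞) {θ : ℝ}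
    (hθ : θ = sSup {q | q ∈ Icc (0 : ℝ) 1 ∧
      r ≤ ENNReal.ofReal (derivWithin (concaveHull U) (Ici q) q)}) :
    concaveHull U θ = U θ := by
  set S := {q | q ∈ Icc (0 : ℝ) 1 ∧
      r ≤ ENNReal.ofReal (derivWithin (concaveHull U) (Ici q) q)} with hS
  have hbdd : BddAbove S := ⟨1, fun q hq => hq.1.2⟩
  have hθ0 : 0 ≤ θ := hθ ▸ Real.sSup_nonneg fun q hq => hq.1.1
  have hθ1 : θ ≤ 1 := hθ ▸ Real.sSup_le (fun q hq => hq.1.2) zero_le_one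
  rcases hθ0.eq_or_lt with h | hθ0
  · rw [← h, concaveHull_zero hU h0 hrc, h0]
  rcases hθ1.eq_or_lt with h | hθ1
  · rw [h, concaveHull_one hU]
  by_contra hne
  obtain ⟨a, b, s, c, ha0, haθ, hθb, hb1, haff⟩ := concaveHull_affine_of_lt hU h0 hrc ⟨hθ0, hθ1⟩
    (lt_of_le_of_ne (le_concaveHull hU ⟨hθ0.le, hθ1.le⟩) (Ne.symm hne))
  have hder : ∀ t ∈ Ico a b, derivWithin (concaveHull U) (Ici t) t = s := by
    intro t ht
    have h1 : HasDerivWithinAt (fun t => s * t + c) s (Ici t) t := by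
      simpa using (((hasDerivAt_id t).const_mul s).add_const c).hasDerivWithinAt
    refine (h1.congr_of_eventuallyEq ?_ (haff t ⟨ht.1, ht.2.le⟩)).derivWithin
      (uniqueDiffWithinAt_Ici t)
    filter_upwards [Icc_mem_nhdsGE ht.2] with x hx
    exact haff x ⟨ht.1.trans hx.1, hx.2⟩
  have hne : S.Nonempty := by
    by_contra h
    rw [not_nonempty_iff_eq_empty] at h
    rw [h, Real.sSup_empty] at hθ
    exact hθ0.ne' hθ
  obtain ⟨q, hqS, haq⟩ := exists_lt_of_lt_csSup hne (hθ ▸ haθ)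
  have hqθ : q ≤ θ := hθ ▸ le_csSup hbdd hqS
  -- the slope at `q ≤ θ` persists to points beyond `θ`
  have hmid : (θ + b) / 2 ∈ S := by
    refine ⟨⟨by linarith, by linarith⟩, ?_⟩
    rw [hder _ ⟨by linarith, by linarith⟩, ← hder q ⟨haq.le, hqθ.trans_lt hθb⟩]
    exact hqS.2
  have : (θ + b) / 2 ≤ θ := (le_csSup hbdd hmid).trans hθ.ge
  linarith

end Hull

/-! ### Quantiles of an atomless distribution -/

section Quantile

variable (F : ProbabilityMeasure ℝ≥0)

/-- The quantile `1 - F(x)` of the value `x`. -/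
def quantile (x : ℝ≥0) : ℝ := 1 - (F : Measure ℝ≥0).real (Iic x)

theorem quantile_antitone : Antitone (quantile F) := fun _ _ h =>
  sub_le_sub_left (measureReal_mono (Iic_subset_Iic.2 h)) 1

theorem measurable_quantile : Measurable (quantile F) := (quantile_antitone F).measurable

theorem quantile_mem_Icc (x : ℝ≥0) : quantile F x ∈ Icc (0 : ℝ) 1 :=
  ⟨sub_nonneg.2 measureReal_le_one, sub_le_self _ measureReal_nonneg⟩

theorem measurable_inverseDemand : Measurable (inverseDemand F) :=
  (inverseDemand_antitone F).measurable

theorem exists_gt_lt_quantile {x : ℝ≥0} {q : ℝ} (h : q < quantile F x) :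
    ∃ y, x < y ∧ q < quantile F y := by
  have ht := tendsto_measure_biInter_gt (μ := (F : Measure ℝ≥0)) (s := Iic) (a := x)
    (fun r _ => measurableSet_Iic.nullMeasurableSet) (fun i j _ hij => Iic_subset_Iic.2 hij)
    ⟨x + 1, by simp, measure_ne_top _ _⟩
  have hI : ⋂ r > x, Iic r = Iic x := by
    ext z
    simp only [mem_iInter, mem_Iic]
    exact ⟨fun h => le_of_forall_gt_imp_ge_of_dense h, fun h r hr => h.trans hr.le⟩
  rw [hI] at ht
  have ht' := (ENNReal.tendsto_toReal (measure_ne_top _ _)).comp ht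
  have hx : (F : Measure ℝ≥0).real (Iic x) < 1 - q := by unfold quantile at h; linarith
  obtain ⟨y, hy, hxy⟩ :=
    ((ht'.eventually_lt_const hx).and self_mem_nhdsWithin).exists
  refine ⟨y, hxy, ?_⟩
  have : (F : Measure ℝ≥0).real (Iic y) < 1 - q := hy
  unfold quantile; linarith

/-- Inverse demand and quantile form a Galois connection. -/
theorem inverseDemand_le_iff {q : ℝ} {x : ℝ≥0} :
    inverseDemand F q ≤ x ↔ quantile F x ≤ q := by
  constructor
  · intro h
    by_contra! hq
    obtain ⟨y, hxy, hy⟩ := exists_gt_lt_quantile F hq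
    have : (y : ℝ≥0∞) ≤ inverseDemand F q := by
      refine le_iInf₂ fun z hz => ?_
      by_contra! hzy
      have := quantile_antitone F (ENNReal.coe_lt_coe.1 hzy).le
      unfold quantile at this hy
      linarith
    exact absurd (this.trans h) (not_le.2 (ENNReal.coe_lt_coe.2 hxy))
  · intro h
    refine iInf₂_le x ?_
    unfold quantile at h
    linarith

theorem exists_quantile_lt {q : ℝ} (hq : 0 < q) : ∃ x, quantile F x < q := by
  have ht := (ENNReal.tendsto_toReal (measure_ne_top _ _)).comp
    (tendsto_measure_Iic_atTop (F : Measure ℝ≥0))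
  have h1 : ((F : Measure ℝ≥0) univ).toReal = 1 := by simp
  rw [h1] at ht
  obtain ⟨x, hx⟩ := (ht.eventually_const_lt (sub_lt_self 1 hq)).exists
  have : 1 - q < (F : Measure ℝ≥0).real (Iic x) := hx
  exact ⟨x, by unfold quantile; linarith⟩

variable {F} (hatom : Atomless F)
include hatom

theorem measure_Ici_eq (x : ℝ≥0) :
    (F : Measure ℝ≥0) (Ici x) = ENNReal.ofReal (quantile F x) := by
  have : NullSingletonClass (F : Measure ℝ≥0) := ⟨hatom⟩
  rw [← measure_congr (Ioi_ae_eq_Ici (μ := (F : Measure ℝ≥0)) (a := x)), ← compl_Iic,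
    ← ofReal_measureReal, probReal_compl_eq_one_sub measurableSet_Iic]
  rfl

theorem measure_quantile_le {θ : ℝ} (hθ : θ ∈ Icc (0 : ℝ) 1) :
    (F : Measure ℝ≥0) {x | quantile F x ≤ θ} = ENNReal.ofReal θ := by
  simp_rw [← inverseDemand_le_iff]
  rcases eq_or_ne (inverseDemand F θ) ∞ with h | h
  · have h0 : θ = 0 := by
      by_contra h0
      obtain ⟨x, hx⟩ := exists_quantile_lt F (lt_of_le_of_ne hθ.1 (Ne.symm h0))
      have := (inverseDemand_le_iff F).2 hx.le
      simp [h] at this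
    subst h0
    simp [h]
  · lift inverseDemand F θ to ℝ≥0 using h with y hy
    have hset : {x : ℝ≥0 | (y : ℝ≥0∞) ≤ x} = Ici y := by ext; simp
    rw [hset, measure_Ici_eq hatom]
    congr 1
    refine le_antisymm ((inverseDemand_le_iff F).1 hy.ge) ?_
    have hlow : ∀ z < y, (F : Measure ℝ≥0) (Iic z) ≤ ENNReal.ofReal (1 - θ) := by
      intro z hz
      have : θ < quantile F z := by
        by_contra! hc
        have := (inverseDemand_le_iff F).2 hc
        rw [← hy, ENNReal.coe_le_coe] at this
        exact absurd hz (not_lt.2 this)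
      rw [← ofReal_measureReal]
      refine ENNReal.ofReal_le_ofReal ?_
      unfold quantile at this
      linarith
    have hIio : (F : Measure ℝ≥0) (Iio y) ≤ ENNReal.ofReal (1 - θ) := by
      rcases eq_or_lt_of_le (zero_le : 0 ≤ y) with h0 | h0
      · simp [← h0]
      obtain ⟨u, hu, hu', hut⟩ := exists_seq_strictMono_tendsto' h0
      have : Iio y = ⋃ n, Iic (u n) := by
        ext z
        simp only [mem_Iio, mem_iUnion, mem_Iic]
        refine ⟨fun hz => ?_, fun ⟨n, hn⟩ => hn.trans_lt (hu' n).2⟩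
        obtain ⟨n, hn⟩ := (hut.eventually_const_lt hz).exists
        exact ⟨n, hn.le⟩
      rw [this, Monotone.measure_iUnion fun m n hmn => Iic_subset_Iic.2 (hu.monotone hmn)]
      exact iSup_le fun n => hlow _ (hu' n).2
    have : NullSingletonClass (F : Measure ℝ≥0) := ⟨hatom⟩
    rw [measure_congr (Iio_ae_eq_Iic (μ := (F : Measure ℝ≥0)) (a := y)), ← ofReal_measureReal,
      ENNReal.ofReal_le_ofReal_iff (sub_nonneg.2 hθ.2)] at hIio
    unfold quantile
    linarith

/-- The quantile of an atomless random value is uniform. -/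
theorem map_quantile :
    (F : Measure ℝ≥0).map (quantile F) = volume.restrict (Icc (0 : ℝ) 1) := by
  have := Measure.isProbabilityMeasure_map (μ := (F : Measure ℝ≥0))
    (measurable_quantile F).aemeasurable
  refine Measure.ext_of_Iic _ _ fun t => ?_
  rw [Measure.map_apply (measurable_quantile F) measurableSet_Iic,
    Measure.restrict_apply measurableSet_Iic]
  rcases lt_or_ge t 0 with h | h
  · have h1 : quantile F ⁻¹' Iic t = ∅ := by
      ext x; simpa using h.trans_le (quantile_mem_Icc F x).1
    have h2 : Iic t ∩ Icc 0 1 = ∅ := by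
      ext x; simp only [mem_inter_iff, mem_Iic, mem_Icc, mem_empty_iff_false, iff_false]
      intro hx; linarith [hx.2.1]
    rw [h1, h2]; simp
  rcases le_total t 1 with h' | h'
  · have h2 : Iic t ∩ Icc 0 1 = Icc 0 t := by
      ext x; simp only [mem_inter_iff, mem_Iic, mem_Icc]
      exact ⟨fun hx => ⟨hx.2.1, hx.1⟩, fun hx => ⟨hx.2, hx.1, hx.2.trans h'⟩⟩
    rw [h2, Real.volume_Icc, sub_zero]
    exact measure_quantile_le hatom ⟨h, h'⟩
  · have h1 : quantile F ⁻¹' Iic t = univ := by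
      ext x; simpa using (quantile_mem_Icc F x).2.trans h'
    have h2 : Iic t ∩ Icc 0 1 = Icc 0 1 := inter_eq_right.2 fun x hx => hx.2.trans h'
    rw [h1, h2]; simp

theorem measure_quantile_eq (θ : ℝ) : (F : Measure ℝ≥0) {x | quantile F x = θ} = 0 := by
  have h := Measure.map_apply (μ := (F : Measure ℝ≥0)) (measurable_quantile F)
    (measurableSet_singleton θ)
  rw [map_quantile hatom] at h
  exact h.symm.trans (by simp)

theorem Ici_ae_eq_quantile_le (x : ℝ≥0) :
    (Ici x : Set ℝ≥0) =ᵐ[(F : Measure ℝ≥0)] {y | quantile F y ≤ quantile F x} := by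
  refine ae_eq_of_subset_of_measure_ge (fun y hy => quantile_antitone F hy) ?_
    measurableSet_Ici.nullMeasurableSet (measure_ne_top _ _)
  rw [measure_Ici_eq hatom, measure_quantile_le hatom (quantile_mem_Icc F x)]

theorem ae_inverseDemand_quantile :
    ∀ᵐ x ∂(F : Measure ℝ≥0), inverseDemand F (quantile F x) = x := by
  obtain ⟨s, hs, hd⟩ := TopologicalSpace.exists_countable_dense ℝ≥0
  have h : ∀ y ∈ s, ∀ᵐ x ∂(F : Measure ℝ≥0), y < x → quantile F x < quantile F y := by
    intro y _
    filter_upwards [Ici_ae_eq_quantile_le hatom y,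
      compl_mem_ae_iff.2 (measure_quantile_eq hatom (quantile F y))] with x _ hx hyx
    exact lt_of_le_of_ne (quantile_antitone F hyx.le) hx
  filter_upwards [(ae_ball_iff hs).2 h] with x hx
  refine le_antisymm ((inverseDemand_le_iff F).2 le_rfl) ?_
  by_contra! hlt
  lift inverseDemand F (quantile F x) to ℝ≥0 using (hlt.trans ENNReal.coe_lt_top).ne with z hz
  obtain ⟨y, hys, hzy, hyx⟩ := hd.exists_between (ENNReal.coe_lt_coe.1 hlt)
  have := (inverseDemand_le_iff F).1 (hz ▸ ENNReal.coe_le_coe.2 hzy.le)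
  exact absurd (hx y hys hyx) (not_lt.2 this)

end Quantile

/-! ### The consumer surplus curve of an atomless distribution -/

section Curve

variable {F : ProbabilityMeasure ℝ≥0} (hmean : FiniteMean F) (hatom : Atomless F)

include hmean in
theorem lintegral_sub_ne_top (c : ℝ≥0∞) :
    ∫⁻ x, ((x : ℝ≥0∞) - c) ∂(F : Measure ℝ≥0) ≠ ∞ :=
  ne_top_of_le_ne_top hmean (lintegral_mono fun _ => tsub_le_self)

include hatom in
theorem lintegral_inverseDemand {θ : ℝ} (hθ : θ ∈ Icc (0 : ℝ) 1) :
    ∫⁻ t in Ioc 0 θ, inverseDemand F t =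
      ∫⁻ x in {x | quantile F x ≤ θ}, (x : ℝ≥0∞) ∂(F : Measure ℝ≥0) := by
  have h1 : volume.restrict (Ioc 0 θ) = ((F : Measure ℝ≥0).map (quantile F)).restrict (Iic θ) := by
    rw [map_quantile hatom, Measure.restrict_restrict measurableSet_Iic]
    have : Iic θ ∩ Icc 0 1 = Icc 0 θ := by
      ext x; simp only [mem_inter_iff, mem_Iic, mem_Icc]
      exact ⟨fun hx => ⟨hx.2.1, hx.1⟩, fun hx => ⟨hx.2, hx.1, hx.2.trans hθ.2⟩⟩
    rw [this]
    exact Measure.restrict_congr_set Ioc_ae_eq_Icc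
  rw [h1, setLIntegral_map measurableSet_Iic (measurable_inverseDemand F) (measurable_quantile F)]
  exact lintegral_congr_ae (ae_restrict_of_ae (ae_inverseDemand_quantile hatom))

include hmean hatom in
/-- The consumer surplus curve is the expected utility from the price `v(θ)`, which may be `∞` at
`θ = 0`. -/
theorem consumerCurve_eq {θ : ℝ} (hθ : θ ∈ Icc (0 : ℝ) 1) :
    consumerCurve F θ =
      (∫⁻ x, ((x : ℝ≥0∞) - inverseDemand F θ) ∂(F : Measure ℝ≥0)).toReal := by
  set c := inverseDemand F θ with hc
  set A := {x | quantile F x ≤ θ} with hA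
  have hAm : MeasurableSet A := measurable_quantile F measurableSet_Iic
  have hAc : ∀ x, x ∈ A ↔ c ≤ x := fun x => (inverseDemand_le_iff F).symm
  have hsub : ∫⁻ x in A, ((x : ℝ≥0∞) - c) ∂(F : Measure ℝ≥0) =
      ∫⁻ x, ((x : ℝ≥0∞) - c) ∂(F : Measure ℝ≥0) := by
    rw [← lintegral_indicator hAm]
    refine lintegral_congr fun x => ?_
    by_cases hx : x ∈ A
    · simp [hx]
    · rw [indicator_of_notMem hx, tsub_eq_zero_of_le]
      rw [hAc] at hx
      exact (not_le.1 hx).le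
  have hsplit : ∫⁻ x in A, (x : ℝ≥0∞) ∂(F : Measure ℝ≥0) =
      ∫⁻ x, ((x : ℝ≥0∞) - c) ∂(F : Measure ℝ≥0) + c * ENNReal.ofReal θ := by
    rw [← hsub, ← measure_quantile_le hatom hθ, ← setLIntegral_const,
      ← lintegral_add_right _ measurable_const]
    refine setLIntegral_congr_fun hAm fun x hx => ?_
    exact (tsub_add_cancel_of_le ((hAc x).1 hx)).symm
  have hfin : ∫⁻ x in A, (x : ℝ≥0∞) ∂(F : Measure ℝ≥0) ≠ ∞ :=
    ne_top_of_le_ne_top hmean (setLIntegral_le_lintegral _ _)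
  have hfin' : c * ENNReal.ofReal θ ≠ ∞ := by
    rw [hsplit] at hfin
    exact (ENNReal.add_ne_top.1 hfin).2
  unfold consumerCurve surplusCurve
  rw [lintegral_inverseDemand hatom hθ, hsplit,
    ENNReal.toReal_add (lintegral_sub_ne_top hmean c) hfin', ENNReal.toReal_mul,
    ENNReal.toReal_ofReal hθ.1, ← hc]
  ring

include hmean hatom in
theorem ofReal_consumerCurve {θ : ℝ} (hθ : θ ∈ Icc (0 : ℝ) 1) :
    ENNReal.ofReal (consumerCurve F θ) =
      ∫⁻ x, ((x : ℝ≥0∞) - inverseDemand F θ) ∂(F : Measure ℝ≥0) := by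
  rw [consumerCurve_eq hmean hatom hθ, ENNReal.ofReal_toReal (lintegral_sub_ne_top hmean _)]

include hmean hatom in
theorem monotoneOn_consumerCurve : MonotoneOn (consumerCurve F) (Icc 0 1) := by
  intro x hx y hy hxy
  rw [consumerCurve_eq hmean hatom hx, consumerCurve_eq hmean hatom hy]
  refine ENNReal.toReal_mono (lintegral_sub_ne_top hmean _) (lintegral_mono fun z => ?_)
  exact tsub_le_tsub_left (inverseDemand_antitone F hxy) _

theorem consumerCurve_zero : consumerCurve F 0 = 0 := by
  simp [consumerCurve, surplusCurve]

theorem tendsto_inverseDemand (q : ℝ) :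
    Filter.Tendsto (inverseDemand F) (nhdsWithin q (Ioi q)) (nhds (inverseDemand F q)) := by
  refine tendsto_order.2 ⟨fun y hy => ?_, fun y hy => ?_⟩
  · obtain ⟨z, hyz, hz⟩ := ENNReal.lt_iff_exists_nnreal_btwn.1 hy
    have hq : q < quantile F z := by
      rw [← not_le, ← inverseDemand_le_iff, not_le]; exact hz
    filter_upwards [Ioo_mem_nhdsGT hq] with b hb
    refine hyz.trans ?_
    rw [← not_le, inverseDemand_le_iff, not_le]; exact hb.2
  · filter_upwards [self_mem_nhdsWithin] with b hb
    exact (inverseDemand_antitone F (le_of_lt hb)).trans_lt hy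

include hmean hatom in
theorem consumerCurve_right_continuous :
    ∀ q ∈ Ico (0 : ℝ) 1, ∀ c, consumerCurve F q < c → ∃ b ∈ Ioo q 1, consumerCurve F b < c := by
  intro q hq c hc
  have hlim : Filter.Tendsto
      (fun b => ∫⁻ x, ((x : ℝ≥0∞) - inverseDemand F b) ∂(F : Measure ℝ≥0))
      (nhdsWithin q (Ioi q))
      (nhds (∫⁻ x, ((x : ℝ≥0∞) - inverseDemand F q) ∂(F : Measure ℝ≥0))) := by
    refine tendsto_lintegral_filter_of_dominated_convergence (fun x => (x : ℝ≥0∞))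
      (Filter.Eventually.of_forall fun b => by fun_prop)
      (Filter.Eventually.of_forall fun b => Filter.Eventually.of_forall fun x => tsub_le_self)
      hmean (Filter.Eventually.of_forall fun x => ?_)
    exact ENNReal.Tendsto.sub tendsto_const_nhds (tendsto_inverseDemand q)
      (Or.inl ENNReal.coe_ne_top)
  have hlim' := (ENNReal.tendsto_toReal (lintegral_sub_ne_top hmean _)).comp hlim
  rw [consumerCurve_eq hmean hatom ⟨hq.1, hq.2.le⟩] at hc
  obtain ⟨b, hb, hbI⟩ := ((hlim'.eventually_lt_const hc).and (Ioo_mem_nhdsGT hq.2)).exists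
  refine ⟨b, hbI, ?_⟩
  rw [consumerCurve_eq hmean hatom ⟨hq.1.trans hbI.1.le, hbI.2.le⟩]
  exact hb

end Curve

/-! ### The ironed virtual value of a value -/

section VirtualValue

/-- The ironed virtual value of the value `x`, as a nonnegative real; its law is `ironedLaw`. -/
def virtualValue (F : ProbabilityMeasure ℝ≥0) (x : ℝ≥0) : ℝ≥0 :=
  (ironedVirtual F (quantile F x)).toNNReal

theorem measurable_virtualValue (F : ProbabilityMeasure ℝ≥0) : Measurable (virtualValue F) :=
  (measurable_ironedVirtual F).comp (measurable_quantile F)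

variable {F : ProbabilityMeasure ℝ≥0} (hmean : FiniteMean F) (hatom : Atomless F)

include hatom in
theorem map_virtualValue :
    (F : Measure ℝ≥0).map (virtualValue F) = (ironedLaw F : Measure ℝ≥0) := by
  have h := Measure.map_map (μ := (F : Measure ℝ≥0)) (measurable_ironedVirtual F)
    (measurable_quantile F)
  rw [map_quantile hatom] at h
  exact h.symm

include hmean hatom in
theorem setLIntegral_virtualValue_quantile {θ : ℝ} (hθ : θ ∈ Icc (0 : ℝ) 1) :
    ∫⁻ x in {x | quantile F x ≤ θ}, (virtualValue F x : ℝ≥0∞) ∂(F : Measure ℝ≥0) =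
      ENNReal.ofReal (concaveHull (consumerCurve F) θ) := by
  rw [← lintegral_derivWithin_concaveHull (monotoneOn_consumerCurve hmean hatom)
    consumerCurve_zero (consumerCurve_right_continuous hmean hatom) hθ]
  have h1 : volume.restrict (Icc 0 θ) = ((F : Measure ℝ≥0).map (quantile F)).restrict (Iic θ) := by
    rw [map_quantile hatom, Measure.restrict_restrict measurableSet_Iic]
    congr 1
    ext x; simp only [mem_inter_iff, mem_Iic, mem_Icc]
    exact ⟨fun hx => ⟨hx.2, hx.1, hx.2.trans hθ.2⟩, fun hx => ⟨hx.2.1, hx.1⟩⟩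
  rw [h1, setLIntegral_map measurableSet_Iic _ (measurable_quantile F)]
  · rfl
  · exact (measurable_derivWithin_Ici _).ennreal_ofReal

include hmean hatom in
/-- Utility from any price is at most the ironed virtual value of those who accept it. -/
theorem lintegral_sub_le_virtualValue (x : ℝ≥0) :
    ∫⁻ y, ((y : ℝ≥0∞) - x) ∂(F : Measure ℝ≥0) ≤
      ∫⁻ y in Ici x, (virtualValue F y : ℝ≥0∞) ∂(F : Measure ℝ≥0) := by
  have hq := quantile_mem_Icc F x
  rw [setLIntegral_congr (Ici_ae_eq_quantile_le hatom x),
    setLIntegral_virtualValue_quantile hmean hatom hq]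
  calc ∫⁻ y, ((y : ℝ≥0∞) - x) ∂(F : Measure ℝ≥0)
      ≤ ∫⁻ y, ((y : ℝ≥0∞) - inverseDemand F (quantile F x)) ∂(F : Measure ℝ≥0) :=
        lintegral_mono fun y => tsub_le_tsub_left ((inverseDemand_le_iff F).2 le_rfl) _
    _ = ENNReal.ofReal (consumerCurve F (quantile F x)) :=
        (ofReal_consumerCurve hmean hatom hq).symm
    _ ≤ _ := ENNReal.ofReal_le_ofReal (le_concaveHull (monotoneOn_consumerCurve hmean hatom) hq)

theorem virtualPrice_quantile_mem (r : ℝ≥0∞) :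
    sSup {θ | θ ∈ Icc (0 : ℝ) 1 ∧ r ≤ ENNReal.ofReal (ironedVirtual F θ)} ∈ Icc (0 : ℝ) 1 :=
  ⟨Real.sSup_nonneg fun _ hq => hq.1.1, Real.sSup_le (fun _ hq => hq.1.2) zero_le_one⟩

include hmean hatom in
/-- At the price of an ironed virtual price, utility equals the ironed virtual value of those who
accept it, because the consumer surplus curve touches its hull there. -/
theorem virtualValue_eq_lintegral_sub_virtualPrice (r : ℝ≥0∞) :
    ∫⁻ y in {y : ℝ≥0 | virtualPrice F r ≤ y}, (virtualValue F y : ℝ≥0∞) ∂(F : Measure ℝ≥0) =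
      ∫⁻ y, ((y : ℝ≥0∞) - virtualPrice F r) ∂(F : Measure ℝ≥0) := by
  set θ := sSup {θ | θ ∈ Icc (0 : ℝ) 1 ∧ r ≤ ENNReal.ofReal (ironedVirtual F θ)} with hθ
  have hθI : θ ∈ Icc (0 : ℝ) 1 := virtualPrice_quantile_mem r
  have hp : virtualPrice F r = inverseDemand F θ := rfl
  simp_rw [hp, inverseDemand_le_iff]
  rw [setLIntegral_virtualValue_quantile hmean hatom hθI,
    concaveHull_eq_at_sSup (monotoneOn_consumerCurve hmean hatom) consumerCurve_zero
      (consumerCurve_right_continuous hmean hatom) r hθ,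
    ofReal_consumerCurve hmean hatom hθI]

include hmean hatom in
/-- Almost surely, a value accepts the price of `r` iff its ironed virtual value accepts `r`. -/
theorem ae_virtualPrice_le_iff (r : ℝ≥0∞) :
    ∀ᵐ x : ℝ≥0 ∂(F : Measure ℝ≥0), virtualPrice F r ≤ x ↔ r ≤ virtualValue F x := by
  set S := {θ | θ ∈ Icc (0 : ℝ) 1 ∧ r ≤ ENNReal.ofReal (ironedVirtual F θ)} with hS
  have hanti := antitoneOn_derivWithin_concaveHull (monotoneOn_consumerCurve hmean hatom)
  -- at the supremum the level may or may not be attained, and at `0` and `1` the right derivative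
  -- need not exist
  filter_upwards [compl_mem_ae_iff.2 (measure_quantile_eq hatom (sSup S)),
    compl_mem_ae_iff.2 (measure_quantile_eq hatom 0),
    compl_mem_ae_iff.2 (measure_quantile_eq hatom 1)] with x hxS hx0 hx1
  have hq := quantile_mem_Icc F x
  have hq' : quantile F x ∈ Ioo (0 : ℝ) 1 :=
    ⟨lt_of_le_of_ne hq.1 (Ne.symm hx0), lt_of_le_of_ne hq.2 hx1⟩
  have hp : virtualPrice F r = inverseDemand F (sSup S) := rfl
  rw [hp, inverseDemand_le_iff]
  constructor
  · intro h
    have hne : S.Nonempty := by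
      by_contra hne
      rw [not_nonempty_iff_eq_empty] at hne
      rw [hne, Real.sSup_empty] at h
      exact absurd h (not_le.2 hq'.1)
    obtain ⟨θ, hθS, hθ⟩ := exists_lt_of_lt_csSup hne (lt_of_le_of_ne h hxS)
    rcases hθS.1.2.eq_or_lt with rfl | hθ1
    · refine hθS.2.trans ?_
      rw [ironedVirtual, ENNReal.ofReal_of_nonpos (derivWithin_concaveHull_one_nonpos
        (monotoneOn_consumerCurve hmean hatom) consumerCurve_zero)]
      exact zero_le
    · exact hθS.2.trans (ENNReal.ofReal_le_ofReal (hanti hq' ⟨hq'.1.trans hθ, hθ1⟩ hθ.le))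
  · intro h
    exact le_csSup ⟨1, fun y hy => hy.1.2⟩ ⟨hq, h⟩

end VirtualValue

/-! ### Product priors -/

section Product

variable {n : ℕ} (F : Fin n → ProbabilityMeasure ℝ≥0)

instance : IsProbabilityMeasure (productLaw F) := by unfold productLaw; infer_instance

theorem lintegral_productLaw_update (i : Fin n) {f : (Fin n → ℝ≥0) → ℝ≥0∞} (hf : Measurable f) :
    ∫⁻ v, f v ∂(productLaw F) =
      ∫⁻ v, ∫⁻ b, f (Function.update v i b) ∂(F i : Measure ℝ≥0) ∂(productLaw F) := by
  have h : ∀ g : (Fin n → ℝ≥0) → ℝ≥0∞, lmarginal (fun i => (F i : Measure ℝ≥0)) {i} g =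
      fun v => ∫⁻ b, g (Function.update v i b) ∂(F i : Measure ℝ≥0) := fun g =>
    lmarginal_singleton g i
  have hm := hf.lmarginal (fun i => (F i : Measure ℝ≥0)) (s := {i})
  rw [h] at hm
  refine lintegral_eq_of_lmarginal_eq {i} hf hm ?_
  rw [h, h]
  simp

/-- If the section of an event in coordinate `i` is empty or consists of the values that accept the
price `x`, then integrals over the event compare like integrals over those values. -/
theorem setLIntegral_le_of_section (i : Fin n) {B : Set (Fin n → ℝ≥0)} (hB : MeasurableSet B)
    {C : (Fin n → ℝ≥0) → Prop} (hC : ∀ v b, C (Function.update v i b) ↔ C v) {x : ℝ≥0∞}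
    (hBC : ∀ v, v ∈ B ↔ C v ∧ x ≤ v i) {f g : ℝ≥0 → ℝ≥0∞} (hf : Measurable f) (hg : Measurable g)
    (h : ∫⁻ y in {y : ℝ≥0 | x ≤ y}, f y ∂(F i : Measure ℝ≥0) ≤
      ∫⁻ y in {y : ℝ≥0 | x ≤ y}, g y ∂(F i : Measure ℝ≥0)) :
    ∫⁻ v in B, f (v i) ∂(productLaw F) ≤ ∫⁻ v in B, g (v i) ∂(productLaw F) := by
  have hx : MeasurableSet {y : ℝ≥0 | x ≤ y} := measurableSet_le measurable_const (by fun_prop)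
  have key : ∀ k : ℝ≥0 → ℝ≥0∞, Measurable k → ∀ v : Fin n → ℝ≥0, C v →
      ∫⁻ b, B.indicator (fun v => k (v i)) (Function.update v i b) ∂(F i : Measure ℝ≥0) =
        ∫⁻ y in {y : ℝ≥0 | x ≤ y}, k y ∂(F i : Measure ℝ≥0) := by
    intro k _ v hv
    rw [← lintegral_indicator hx]
    refine lintegral_congr fun b => ?_
    simp [indicator, hBC, hC, hv]
  rw [← lintegral_indicator hB, ← lintegral_indicator hB,
    lintegral_productLaw_update F i (f := B.indicator fun v => f (v i))
      ((hf.comp (measurable_pi_apply i)).indicator hB),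
    lintegral_productLaw_update F i (f := B.indicator fun v => g (v i))
      ((hg.comp (measurable_pi_apply i)).indicator hB)]
  refine lintegral_mono fun v => ?_
  by_cases hv : C v
  · exact (key f hf v hv).trans_le (h.trans (key g hg v hv).ge)
  · refine le_of_eq_of_le ?_ zero_le
    simp [indicator, hBC, hC, hv]

theorem map_virtualValue_productLaw (hatom : ∀ i, Atomless (F i)) :
    (productLaw F).map (fun v i => virtualValue (F i) (v i)) =
      productLaw fun i => ironedLaw (F i) := by
  unfold productLaw
  rw [Measure.pi_map_pi fun i => (measurable_virtualValue (F i)).aemeasurable]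
  simp_rw [map_virtualValue (hatom _)]

theorem measurable_virtualValue_pi :
    Measurable fun (v : Fin n → ℝ≥0) i => virtualValue (F i) (v i) :=
  measurable_pi_lambda _ fun i => (measurable_virtualValue (F i)).comp (measurable_pi_apply i)

theorem measurable_optimum (Feas : Finset (Finset (Fin n))) :
    Measurable fun v : Fin n → ℝ≥0 => Feas.sup fun S => ∑ i ∈ S, (v i : ℝ≥0∞) := by
  simp_rw [Finset.sup_eq_iSup]
  exact .iSup fun S => .iSup fun _ => by fun_prop

/-- The optimal surplus for the ironed virtual values, in terms of the values. -/
theorem optSurplus_ironedLaw (Feas : Finset (Finset (Fin n))) (hatom : ∀ i, Atomless (F i)) :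
    optSurplus Feas (fun i => ironedLaw (F i)) =
      ∫⁻ v, Feas.sup (fun S => ∑ i ∈ S, (virtualValue (F i) (v i) : ℝ≥0∞)) ∂(productLaw F) := by
  unfold optSurplus
  rw [← map_virtualValue_productLaw F hatom,
    lintegral_map (measurable_optimum Feas) (measurable_virtualValue_pi F)]

end Product

/-! ### Histories of a pen testing algorithm -/

section Histories

variable {n : ℕ}

/-- The total time for which each pen has been tested after the signals `h` (most recent first),
when the tests follow the deterministic strategy `σ`. -/
def spent (σ : List Bool → PenAction n) : List Bool → Fin n → ℝ≥0∞
  | [], _ => 0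
  | _ :: h, i => spent σ h i +
      match σ h with
      | PenAction.test j θ => if j = i then θ else 0
      | PenAction.output _ => 0

/-- The signals `h` are those that the strategy `σ` receives at the ink levels `v`. -/
def Consistent (σ : List Bool → PenAction n) (v : Fin n → ℝ≥0) : List Bool → Prop
  | [] => True
  | b :: h => Consistent σ v h ∧
      match σ h with
      | PenAction.test j θ => b = decide (θ ≤ (v j : ℝ≥0∞) - spent σ h j)
      | PenAction.output _ => False

theorem measurableSet_consistent (σ : List Bool → PenAction n) (h : List Bool) :
    MeasurableSet {v | Consistent σ v h} := by
  induction h with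
  | nil => simp [Consistent]
  | cons b h ih =>
    cases hσ : σ h with
    | output P => simp [Consistent, hσ]
    | test j θ =>
      have hm : MeasurableSet {v : Fin n → ℝ≥0 | θ ≤ (v j : ℝ≥0∞) - spent σ h j} :=
        measurableSet_le measurable_const (by fun_prop)
      simp only [Consistent, hσ, ofPred_and]
      refine ih.inter ?_
      cases b
      · convert hm.compl using 1
        ext; simp
      · convert hm using 1
        ext; simp

/-- As a condition on the ink level of pen `i` alone, a history says that the ink level is at least
the time spent, or else the pen is empty. -/
theorem consistent_section (σ : List Bool → PenAction n) (i : Fin n) (h : List Bool) :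
    (∃ C : (Fin n → ℝ≥0) → Prop, (∀ v b, C (Function.update v i b) ↔ C v) ∧
      ∀ v, Consistent σ v h ↔ C v ∧ spent σ h i ≤ v i) ∨
    ∀ v, Consistent σ v h → (v i : ℝ≥0∞) - spent σ h i = 0 := by
  induction h with
  | nil => exact Or.inl ⟨fun _ => True, by simp, by simp [Consistent, spent]⟩
  | cons b h ih =>
    cases hσ : σ h with
    | output P => exact Or.inr fun v hv => by simp [Consistent, hσ] at hv
    | test j θ =>
      rcases ih with ⟨C, hC, hBC⟩ | h0
      · by_cases hji : j = i
        · subst hji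
          cases b with
          | false =>
            refine Or.inr fun v hv => ?_
            simp only [Consistent, hσ] at hv
            have : ¬ θ ≤ (v j : ℝ≥0∞) - spent σ h j := by simpa using hv.2
            simp only [spent, hσ, if_true]
            rw [← tsub_tsub]
            exact tsub_eq_zero_of_le (not_le.1 this).le
          | true =>
            refine Or.inl ⟨C, hC, fun v => ?_⟩
            simp only [Consistent, hσ, spent, if_true, hBC, and_assoc]
            refine and_congr_right fun _ => ⟨fun ⟨h1, h2⟩ => ?_, fun h1 => ?_⟩
            · have h2 : θ ≤ (v j : ℝ≥0∞) - spent σ h j := by simpa using h2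
              exact (add_le_add_right h2 _).trans_eq (add_tsub_cancel_of_le h1)
            · refine ⟨le_self_add.trans h1, ?_⟩
              have : spent σ h j ≠ ∞ :=
                ne_top_of_le_ne_top ENNReal.coe_ne_top (le_self_add.trans h1)
              simpa using (ENNReal.le_sub_of_add_le_left this h1)
        · refine Or.inl ⟨fun v => C v ∧ b = decide (θ ≤ (v j : ℝ≥0∞) - spent σ h j),
            fun v y => ?_, fun v => ?_⟩
          · simp only [hC, Function.update_of_ne hji]
          · simp only [Consistent, hσ, spent, hBC, if_neg hji, add_zero]
            tauto
      · refine Or.inr fun v hv => ?_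
        simp only [Consistent, hσ] at hv
        simp only [spent]
        rw [← tsub_tsub, h0 v hv.1, zero_tsub]

variable (alg : PenAlg n) (ω : alg.Seed) (v : Fin n → ℝ≥0)

namespace PenAlg

theorem run_succ (t : ℕ) : alg.run ω v (t + 1) = alg.step ω (alg.run ω v t) :=
  Function.iterate_succ_apply' _ _ _

theorem run_consistent (t : ℕ) :
    Consistent (alg.strategy ω) v (alg.run ω v t).2 ∧
      ∀ i, (alg.run ω v t).1 i = v i - spent (alg.strategy ω) (alg.run ω v t).2 i := by
  induction t with
  | zero => simp [run, Consistent, spent]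
  | succ t ih =>
    rw [run_succ]
    cases hσ : alg.strategy ω (alg.run ω v t).2 with
    | output P => simpa [step, hσ] using ih
    | test j θ =>
      simp only [step, hσ, Consistent, spent]
      refine ⟨⟨ih.1, by rw [ih.2]⟩, fun i => ?_⟩
      by_cases hji : j = i
      · subst hji
        simp [ih.2, tsub_tsub]
      · simp [hji, Function.update_of_ne (Ne.symm hji), ih.2]

theorem run_length {h : List Bool} (hc : Consistent (alg.strategy ω) v h) :
    (alg.run ω v h.length).2 = h := by
  induction h with
  | nil => rfl
  | cons b h ih =>
    have ih' := ih hc.1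
    have hs := (alg.run_consistent ω v h.length).2
    rw [List.length_cons, run_succ]
    cases hσ : alg.strategy ω h with
    | output P => simp [Consistent, hσ] at hc
    | test j θ =>
      simp only [Consistent, hσ] at hc
      simp only [step, ih', hσ]
      rw [hs j, ih', hc.2]

theorem run_add_of_output {t : ℕ} {P : Finset (Fin n)}
    (h : alg.strategy ω (alg.run ω v t).2 = PenAction.output P) (k : ℕ) :
    alg.run ω v (t + k) = alg.run ω v t := by
  induction k with
  | zero => rfl
  | succ k ih => rw [← add_assoc, run_succ, ih, step, h]

/-- Two histories at the same ink levels at which the algorithm has stopped are equal. -/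
theorem eq_of_output {t : ℕ} {P Q : Finset (Fin n)} {h : List Bool}
    (ht : alg.strategy ω (alg.run ω v t).2 = PenAction.output P)
    (hc : Consistent (alg.strategy ω) v h) (hQ : alg.strategy ω h = PenAction.output Q) :
    h = (alg.run ω v t).2 := by
  have hl := alg.run_length ω v hc
  rw [← hl] at hQ
  have h1 := alg.run_add_of_output ω v ht h.length
  have h2 := alg.run_add_of_output ω v hQ t
  rw [add_comm, h1] at h2
  rw [h2, hl]

end PenAlg

/-- The set output after the signals `h`, or the empty set. -/
def outputSet (σ : List Bool → PenAction n) (h : List Bool) : Finset (Fin n) :=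
  match σ h with
  | PenAction.test _ _ => ∅
  | PenAction.output P => P

theorem PenAlg.payoff_le_tsum :
    alg.payoff ω v ≤ ∑' h, {v | Consistent (alg.strategy ω) v h}.indicator
      (fun v => ∑ i ∈ outputSet (alg.strategy ω) h,
        ((v i : ℝ≥0∞) - spent (alg.strategy ω) h i)) v := by
  refine iSup_le fun t => ?_
  refine le_trans ?_ (ENNReal.le_tsum (alg.run ω v t).2)
  obtain ⟨h1, h2⟩ := alg.run_consistent ω v t
  rw [indicator_of_mem (by exact h1)]
  unfold payoffAt outputSet
  cases alg.strategy ω (alg.run ω v t).2 with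
  | test => simp
  | output P => simp [h2]

variable {F : Fin n → ProbabilityMeasure ℝ≥0} (hmean : ∀ i, FiniteMean (F i))
  (hatom : ∀ i, Atomless (F i))
include hmean hatom

/-- On each history, the residual ink of a pen is at most its ironed virtual value. -/
theorem setLIntegral_residual_le (σ : List Bool → PenAction n) (h : List Bool) (i : Fin n) :
    ∫⁻ v in {v | Consistent σ v h}, ((v i : ℝ≥0∞) - spent σ h i) ∂(productLaw F) ≤
      ∫⁻ v in {v | Consistent σ v h}, (virtualValue (F i) (v i) : ℝ≥0∞) ∂(productLaw F) := by
  have hB := measurableSet_consistent σ h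
  rcases consistent_section σ i h with ⟨C, hC, hBC⟩ | h0
  · refine setLIntegral_le_of_section F i hB hC hBC
      (f := fun y => (y : ℝ≥0∞) - spent σ h i) (g := fun y => (virtualValue (F i) y : ℝ≥0∞))
      (by fun_prop) (measurable_virtualValue _).coe_nnreal_ennreal ?_
    rcases eq_or_ne (spent σ h i) ∞ with hx | hx
    · simp [hx]
    · lift spent σ h i to ℝ≥0 using hx with x
      have : {y : ℝ≥0 | (x : ℝ≥0∞) ≤ y} = Ici x := by ext; simp
      rw [this]
      exact (setLIntegral_le_lintegral _ _).trans
        (lintegral_sub_le_virtualValue (hmean i) (hatom i) x)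
  · rw [setLIntegral_congr_fun hB (g := fun _ => 0) fun v hv => h0 v hv]
    simp

/-- For a fixed seed, the expected residual ink of the output is at most its expected ironed
virtual value. -/
theorem PenAlg.lintegral_payoff_le {Feas : Finset (Finset (Fin n))}
    (hvalid : ∀ᵐ v ∂(productLaw F),
      ∃ t, ∃ P ∈ Feas, alg.strategy ω (alg.run ω v t).2 = PenAction.output P) :
    ∫⁻ v, alg.payoff ω v ∂(productLaw F) ≤ optSurplus Feas fun i => ironedLaw (F i) := by
  set σ := alg.strategy ω with hσ
  have hB := measurableSet_consistent σ
  have hw : ∀ i, Measurable fun v : Fin n → ℝ≥0 => (virtualValue (F i) (v i) : ℝ≥0∞) := fun i =>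
    ((measurable_virtualValue _).comp (measurable_pi_apply i)).coe_nnreal_ennreal
  have hr : ∀ h i, Measurable fun v : Fin n → ℝ≥0 => (v i : ℝ≥0∞) - spent σ h i :=
    fun h i => by fun_prop
  calc ∫⁻ v, alg.payoff ω v ∂(productLaw F)
      ≤ ∫⁻ v, ∑' h, {v | Consistent σ v h}.indicator
          (fun v => ∑ i ∈ outputSet σ h, ((v i : ℝ≥0∞) - spent σ h i)) v ∂(productLaw F) :=
        lintegral_mono fun v => alg.payoff_le_tsum ω v
    _ = ∑' h, ∫⁻ v in {v | Consistent σ v h},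
          ∑ i ∈ outputSet σ h, ((v i : ℝ≥0∞) - spent σ h i) ∂(productLaw F) := by
        rw [lintegral_tsum fun h =>
          ((Finset.measurable_fun_sum _ fun i _ => hr h i).indicator (hB h)).aemeasurable]
        simp_rw [lintegral_indicator (hB _)]
    _ ≤ ∑' h, ∫⁻ v in {v | Consistent σ v h},
          ∑ i ∈ outputSet σ h, (virtualValue (F i) (v i) : ℝ≥0∞) ∂(productLaw F) := by
        refine ENNReal.tsum_le_tsum fun h => ?_
        rw [lintegral_finsetSum _ fun i _ => hr h i, lintegral_finsetSum _ fun i _ => hw i]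
        exact Finset.sum_le_sum fun i _ => setLIntegral_residual_le hmean hatom σ h i
    _ = ∫⁻ v, ∑' h, {v | Consistent σ v h}.indicator
          (fun v => ∑ i ∈ outputSet σ h, (virtualValue (F i) (v i) : ℝ≥0∞)) v ∂(productLaw F) := by
        rw [lintegral_tsum fun h =>
          ((Finset.measurable_fun_sum _ fun i _ => hw i).indicator (hB h)).aemeasurable]
        simp_rw [lintegral_indicator (hB _)]
    _ ≤ ∫⁻ v, Feas.sup (fun S => ∑ i ∈ S, (virtualValue (F i) (v i) : ℝ≥0∞)) ∂(productLaw F) := by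
        refine lintegral_mono_ae ?_
        filter_upwards [hvalid] with v ⟨t, P, hP, ht⟩
        rw [tsum_eq_single (alg.run ω v t).2]
        · refine (indicator_le_self _ _ _).trans ?_
          have hout : outputSet σ (alg.run ω v t).2 = P := by simp only [outputSet, ht]
          rw [hout]
          exact Finset.le_sup (f := fun S => ∑ i ∈ S, (virtualValue (F i) (v i) : ℝ≥0∞)) hP
        · intro h hne
          by_cases hc : Consistent σ v h
          · cases hQ : σ h with
            | test => simp [outputSet, hQ]
            | output Q => exact absurd (alg.eq_of_output ω v ht hc hQ) hne
          · exact indicator_of_notMem (s := {v | Consistent σ v h}) hc _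
    _ = optSurplus Feas fun i => ironedLaw (F i) := (optSurplus_ironedLaw F Feas hatom).symm

/-- The standard benchmark is at most the optimal surplus for the ironed virtual values. -/
theorem standardBenchmark_le (Feas : Finset (Finset (Fin n))) :
    standardBenchmark Feas F ≤ optSurplus Feas fun i => ironedLaw (F i) := by
  refine iSup₂_le fun alg hvalid => ?_
  unfold PenAlg.performance
  refine (lintegral_prod_le _).trans ?_
  calc _ ≤ ∫⁻ _, optSurplus Feas (fun i => ironedLaw (F i)) ∂alg.seedLaw := by
        refine lintegral_mono_ae ?_
        filter_upwards [Measure.ae_ae_of_ae_prod hvalid] with ω hω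
        exact alg.lintegral_payoff_le ω hmean hatom hω
    _ = _ := by simp

end Histories

/-! ### Histories of a deferred-acceptance auction -/

namespace DAAuction

variable {n : ℕ} (D : DAAuction n) (Feas : Finset (Finset (Fin n)))

/-- The auction reaches the active set `A` after the earlier active sets `h`. -/
def Reach (ω : D.Seed) (v : Fin n → ℝ≥0) : Finset (Fin n) → List (Finset (Fin n)) → Prop
  | A, [] => A = Finset.univ
  | A, B :: h => Reach ω v B h ∧ B ∉ Feas ∧ ∀ i, i ∈ A ↔ i ∈ B ∧ D.price ω B h i ≤ v i

theorem measurableSet_reach (A : Finset (Fin n)) (h : List (Finset (Fin n))) :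
    MeasurableSet {x : D.Seed × (Fin n → ℝ≥0) | D.Reach Feas x.1 x.2 A h} := by
  induction h generalizing A with
  | nil => simp [Reach]
  | cons B h ih =>
    simp only [Reach]
    refine (ih B).inter ((MeasurableSet.const _).inter ?_)
    have hi : ∀ i, MeasurableSet {x : D.Seed × (Fin n → ℝ≥0) |
        i ∈ A ↔ i ∈ B ∧ D.price x.1 B h i ≤ x.2 i} := fun i => by
      have hle : MeasurableSet {x : D.Seed × (Fin n → ℝ≥0) | D.price x.1 B h i ≤ x.2 i} :=
        measurableSet_le ((D.measurable_price B h i).comp measurable_fst) (by fun_prop)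
      by_cases hA : i ∈ A <;> by_cases hB : i ∈ B
      · simpa only [hA, hB, true_iff, true_and] using hle
      · simp [hA, hB]
      · simp only [hA, hB, false_iff, true_and]
        exact hle.compl
      · simp [hA, hB]
    have hall := MeasurableSet.iInter hi
    rw [← ofPred_forall] at hall
    exact hall

variable (ω : D.Seed) (v : Fin n → ℝ≥0)

theorem run_succ (t : ℕ) : D.run Feas ω v (t + 1) = D.step Feas ω v (D.run Feas ω v t) :=
  Function.iterate_succ_apply' _ _ _

theorem reach_run (t : ℕ) : D.Reach Feas ω v (D.run Feas ω v t).1 (D.run Feas ω v t).2 := by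
  induction t with
  | zero => simp [run, Reach]
  | succ t ih =>
    rw [run_succ, step]
    split_ifs with hA
    · exact ih
    · exact ⟨ih, hA, by simp⟩

variable {Feas ω v}

theorem Reach.run_length {A : Finset (Fin n)} {h : List (Finset (Fin n))}
    (hr : D.Reach Feas ω v A h) : D.run Feas ω v h.length = (A, h) := by
  induction h generalizing A with
  | nil =>
    rw [show A = Finset.univ from hr]
    rfl
  | cons B h ih =>
    obtain ⟨hB, hF, hA⟩ := hr
    rw [List.length_cons, run_succ, ih hB, step, if_neg hF]
    congr 1
    ext i
    simp [hA]

theorem run_add_of_mem {t : ℕ} (ht : (D.run Feas ω v t).1 ∈ Feas) (k : ℕ) :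
    D.run Feas ω v (t + k) = D.run Feas ω v t := by
  induction k with
  | zero => rfl
  | succ k ih => rw [← add_assoc, run_succ, ih, step, if_pos ht]

theorem Reach.eq_run {A : Finset (Fin n)} {h : List (Finset (Fin n))}
    (hr : D.Reach Feas ω v A h) (hA : A ∈ Feas) {t : ℕ} (ht : (D.run Feas ω v t).1 ∈ Feas) :
    (A, h) = D.run Feas ω v t := by
  have hl := hr.run_length
  have h1 := D.run_add_of_mem ht h.length
  have h2 := D.run_add_of_mem (t := h.length) (by rw [hl]; exact hA) t
  rw [add_comm, h1] at h2
  rw [h2, hl]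

theorem Reach.standing_le {A : Finset (Fin n)} {h : List (Finset (Fin n))}
    (hr : D.Reach Feas ω v A h) {i : Fin n} (hi : i ∈ A) : D.standing ω h i ≤ v i := by
  cases h with
  | nil => simp [standing]
  | cons B h => exact ((hr.2.2 i).1 hi).2

theorem Reach.standing_le_price {A : Finset (Fin n)} {h : List (Finset (Fin n))}
    (hr : D.Reach Feas ω v A h) (i : Fin n) : D.standing ω h i ≤ D.price ω A h i := by
  cases h with
  | nil => simp [standing]
  | cons B h => exact D.price_mono ω A B h i fun j hj => ((hr.2.2 j).1 hj).1

variable (Feas ω)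

/-- As a condition on the value of an active agent alone, a history says that the value is at least
the standing price. -/
theorem reach_section {i : Fin n} (A : Finset (Fin n)) (h : List (Finset (Fin n))) (hi : i ∈ A) :
    ∃ C : (Fin n → ℝ≥0) → Prop, (∀ v b, C (Function.update v i b) ↔ C v) ∧
      ∀ v, D.Reach Feas ω v A h ↔ C v ∧ D.standing ω h i ≤ v i := by
  induction h generalizing A with
  | nil => exact ⟨fun _ => A = Finset.univ, by simp, by simp [Reach, standing]⟩
  | cons B h ih =>
    by_cases hB : i ∈ B ∧ D.standing ω h i ≤ D.price ω B h i
    · obtain ⟨C, hC, hBC⟩ := ih B hB.1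
      refine ⟨fun v => C v ∧ B ∉ Feas ∧ ∀ j, j ≠ i → (j ∈ A ↔ j ∈ B ∧ D.price ω B h j ≤ v j),
        fun v b => ?_, fun v => ?_⟩
      · refine and_congr (hC v b) (and_congr_right fun _ => forall₂_congr fun j hj => ?_)
        rw [Function.update_of_ne hj]
      · simp only [Reach, hBC, standing]
        constructor
        · rintro ⟨⟨h1, h2⟩, h3, h4⟩
          exact ⟨⟨h1, h3, fun j _ => h4 j⟩, ((h4 i).1 hi).2⟩
        · rintro ⟨⟨h1, h3, h4⟩, h5⟩
          refine ⟨⟨h1, hB.2.trans h5⟩, h3, fun j => ?_⟩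
          by_cases hj : j = i
          · subst hj
            exact iff_of_true hi ⟨hB.1, h5⟩
          · exact h4 j hj
    · refine ⟨fun _ => False, by simp, fun v => iff_of_false (fun hr => hB ?_) (by simp)⟩
      exact ⟨((hr.2.2 i).1 hi).1, hr.1.standing_le_price D i⟩

variable (v)

/-- The value of `φ` at the state in which the auction stops, or `0` if it does not stop. -/
def final (φ : Finset (Fin n) × List (Finset (Fin n)) → ℝ≥0∞) : ℝ≥0∞ :=
  ⨆ t, if (D.run Feas ω v t).1 ∈ Feas then φ (D.run Feas ω v t) else 0

open Classical in
theorem final_eq_tsum (φ : Finset (Fin n) × List (Finset (Fin n)) → ℝ≥0∞) :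
    D.final Feas ω v φ = ∑' s, if s.1 ∈ Feas ∧ D.Reach Feas ω v s.1 s.2 then φ s else 0 := by
  unfold final
  by_cases hex : ∃ t, (D.run Feas ω v t).1 ∈ Feas
  · obtain ⟨t, ht⟩ := hex
    have huniq : ∀ s : Finset (Fin n) × List (Finset (Fin n)),
        s.1 ∈ Feas ∧ D.Reach Feas ω v s.1 s.2 → s = D.run Feas ω v t := fun s hs =>
      hs.2.eq_run D hs.1 ht
    rw [tsum_eq_single (D.run Feas ω v t) fun s hs => if_neg fun h => hs (huniq s h),
      if_pos ⟨ht, D.reach_run Feas ω v t⟩]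
    refine le_antisymm (iSup_le fun k => ?_) (le_iSup_of_le t (by rw [if_pos ht]))
    split_ifs with hk
    · rw [huniq _ ⟨hk, D.reach_run Feas ω v k⟩]
    · exact zero_le
  · push Not at hex
    simp only [if_neg (hex _), iSup_const]
    refine (ENNReal.tsum_eq_zero.2 fun s => if_neg fun hs => hex s.2.length ?_).symm
    rw [hs.2.run_length]
    exact hs.1

end DAAuction

/-! ### Simulation of an auction by tests -/

namespace DAAuction

variable {n : ℕ} (D : DAAuction n) (Feas : Finset (Finset (Fin n))) (ω : D.Seed)
  (v : Fin n → ℝ≥0)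

/-- The tests of one stage: once the pending pens `l` have been tested, exactly those that can pay
the new price have been added to the staying pens. -/
theorem toPenAlg_stage (A : Finset (Fin n)) (past : List (Finset (Fin n))) (l : List (Fin n)) :
    ∀ (st : Finset (Fin n)) (t : ℕ), l ≠ [] → l.Nodup →
      ClockState.replay Feas ((D.toPenAlg Feas).run ω v t).2 = ⟨A, past, l, st⟩ →
      (∀ i ∈ l, ((D.toPenAlg Feas).run ω v t).1 i = v i - D.standing ω past i ∧
        D.standing ω past i ≤ v i ∧ D.standing ω past i ≤ D.price ω A past i) →
      ∃ t' S, ClockState.replay Feas ((D.toPenAlg Feas).run ω v t').2 =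
          ClockState.enter Feas S (A :: past) ∧
        (∀ j, j ∈ S ↔ j ∈ st ∨ j ∈ l ∧ D.price ω A past j ≤ v j) ∧
        (∀ j ∉ l, ((D.toPenAlg Feas).run ω v t').1 j = ((D.toPenAlg Feas).run ω v t).1 j) ∧
        ∀ j ∈ l, ((D.toPenAlg Feas).run ω v t').1 j = v j - D.price ω A past j := by
  induction l with
  | nil => exact fun _ _ h => absurd rfl h
  | cons i l ih =>
    intro st t _ hnd hrep hu
    obtain ⟨hui, hsv, hsp⟩ := hu i List.mem_cons_self
    have hstrat : (D.toPenAlg Feas).strategy ω ((D.toPenAlg Feas).run ω v t).2 =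
        PenAction.test i (D.price ω A past i - D.standing ω past i) := by
      change D.action ω (ClockState.replay Feas _) = _
      rw [hrep]
      rfl
    have hpass : D.price ω A past i - D.standing ω past i ≤
        ((D.toPenAlg Feas).run ω v t).1 i ↔ D.price ω A past i ≤ v i := by
      rw [hui, tsub_le_iff_right, tsub_add_cancel_of_le hsv]
    have hnew : ((D.toPenAlg Feas).run ω v t).1 i -
        (D.price ω A past i - D.standing ω past i) = v i - D.price ω A past i := by
      rw [hui, tsub_tsub, add_tsub_cancel_of_le hsp]
    have hstep := (D.toPenAlg Feas).run_succ ω v t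
    simp only [PenAlg.step, hstrat, hnew, hpass] at hstep
    set b := decide (D.price ω A past i ≤ (v i : ℝ≥0∞)) with hb
    have hrep' : ClockState.replay Feas ((D.toPenAlg Feas).run ω v (t + 1)).2 =
        ClockState.update Feas b ⟨A, past, i :: l, st⟩ := by
      rw [hstep, ← hrep]
      rfl
    have hst : ∀ j, j ∈ (if b then insert i st else st) ↔
        j ∈ st ∨ j = i ∧ D.price ω A past j ≤ v j := by
      intro j
      by_cases hp : D.price ω A past i ≤ (v i : ℝ≥0∞)
      · simp only [hb, hp, decide_true, if_true, Finset.mem_insert]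
        constructor
        · rintro (rfl | h)
          · exact Or.inr ⟨rfl, hp⟩
          · exact Or.inl h
        · rintro (h | ⟨rfl, -⟩)
          · exact Or.inr h
          · exact Or.inl rfl
      · simp only [hb, hp, decide_false, Bool.false_eq_true, if_false]
        refine ⟨Or.inl, ?_⟩
        rintro (h | ⟨rfl, h⟩)
        · exact h
        · exact absurd h hp
    cases l with
    | nil =>
      refine ⟨t + 1, _, hrep', fun j => ?_, fun j hj => ?_, fun j hj => ?_⟩
      · simpa using hst j
      · rw [List.mem_singleton] at hj
        rw [hstep]
        exact Function.update_of_ne hj _ _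
      · rw [List.mem_singleton] at hj
        rw [hstep, hj]
        exact Function.update_self _ _ _
    | cons j l =>
      obtain ⟨t', S, h1, h2, h3, h4⟩ := ih _ (t + 1) (by simp) hnd.of_cons hrep' fun k hk => by
        have hki : k ≠ i := by
          rintro rfl
          exact (List.nodup_cons.1 hnd).1 hk
        refine ⟨?_, (hu k (List.mem_cons_of_mem _ hk)).2⟩
        rw [hstep, ← (hu k (List.mem_cons_of_mem _ hk)).1]
        exact Function.update_of_ne hki _ _
      refine ⟨t', S, h1, fun k => ?_, fun k hk => ?_, fun k hk => ?_⟩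
      · rw [h2, hst, List.mem_cons (a := k) (b := i)]
        tauto
      · rw [h3 k fun h => hk (List.mem_cons_of_mem _ h), hstep]
        exact Function.update_of_ne (fun h => hk (by rw [h]; exact List.mem_cons_self)) _ _
      · rcases List.mem_cons.1 hk with rfl | hk'
        · rw [h3 k (List.nodup_cons.1 hnd).1, hstep]
          exact Function.update_self _ _ _
        · exact h4 k hk'

variable {Feas ω v}

/-- The algorithm passes through the stages of the auction, at which the active pens have been used
up to their standing prices.  An infeasible empty active set is excluded: there the auction never
stops, whereas the algorithm has nothing left to test and outputs it. -/
theorem Reach.exists_run {A : Finset (Fin n)} {h : List (Finset (Fin n))}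
    (hr : D.Reach Feas ω v A h) (hA : A ∈ Feas ∨ A.Nonempty) :
    ∃ t, ClockState.replay Feas ((D.toPenAlg Feas).run ω v t).2 = ClockState.enter Feas A h ∧
      ∀ i ∈ A, ((D.toPenAlg Feas).run ω v t).1 i = v i - D.standing ω h i := by
  induction h generalizing A with
  | nil =>
    refine ⟨0, ?_, fun i _ => ?_⟩
    · rw [show A = Finset.univ from hr]
      rfl
    · simp [PenAlg.run, standing]
  | cons B h ih =>
    obtain ⟨hB, hF, hAB⟩ := id hr
    have hBne : B.Nonempty := by
      rcases B.eq_empty_or_nonempty with rfl | hne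
      · have : A = ∅ := Finset.eq_empty_of_forall_notMem fun i hi => by simpa using (hAB i).1 hi
        subst this
        exact absurd hA (by simp [hF])
      · exact hne
    obtain ⟨t, ht, hu⟩ := ih hB (Or.inr hBne)
    simp only [ClockState.enter, if_neg hF] at ht
    obtain ⟨t', S, h1, h2, -, h4⟩ := D.toPenAlg_stage Feas ω v B h _ ∅ t
      (by
        obtain ⟨i, hi⟩ := hBne
        exact List.ne_nil_of_mem (a := i) (by simp [hi]))
      ((List.nodup_finRange n).filter _) ht
      (fun i hi => by
        have hi : i ∈ B := by simpa using hi
        exact ⟨hu i hi, hB.standing_le D hi, hB.standing_le_price D i⟩)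
    have hSA : S = A := by
      ext i
      simp [h2, hAB]
    subst hSA
    refine ⟨t', h1, fun i hi => ?_⟩
    exact h4 i (by simpa using ((hAB i).1 hi).1)

/-- When the auction stops, so does the algorithm, with the same set. -/
theorem exists_output {t : ℕ} (ht : (D.run Feas ω v t).1 ∈ Feas) :
    ∃ τ, (D.toPenAlg Feas).strategy ω ((D.toPenAlg Feas).run ω v τ).2 =
        PenAction.output (D.run Feas ω v t).1 ∧
      ∀ i ∈ (D.run Feas ω v t).1, ((D.toPenAlg Feas).run ω v τ).1 i =
        v i - D.standing ω (D.run Feas ω v t).2 i := by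
  obtain ⟨τ, h1, h2⟩ := (D.reach_run Feas ω v t).exists_run D (Or.inl ht)
  refine ⟨τ, ?_, h2⟩
  change D.action ω (ClockState.replay Feas _) = _
  rw [h1]
  simp [ClockState.enter, ht, action]

/-- The residual ink of the algorithm is at least the winners' utility at their standing prices. -/
theorem final_le_payoff :
    D.final Feas ω v (fun s => ∑ i ∈ s.1, ((v i : ℝ≥0∞) - D.standing ω s.2 i)) ≤
      (D.toPenAlg Feas).payoff ω v := by
  refine iSup_le fun t => ?_
  split_ifs with ht
  · obtain ⟨τ, h1, h2⟩ := D.exists_output ht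
    refine le_trans ?_ (le_iSup _ τ)
    unfold PenAlg.payoffAt
    rw [h1]
    exact (Finset.sum_congr rfl h2).ge
  · exact zero_le

end DAAuction

/-! ### The virtual-pricing transformation -/

theorem virtualPrice_zero (F : ProbabilityMeasure ℝ≥0) : virtualPrice F 0 = 0 := by
  have : {θ | θ ∈ Icc (0 : ℝ) 1 ∧ 0 ≤ ENNReal.ofReal (ironedVirtual F θ)} = Icc 0 1 := by
    ext; simp
  rw [virtualPrice, this, csSup_Icc zero_le_one]
  simpa using (inverseDemand_le_iff F (x := 0)).2 (quantile_mem_Icc F 0).2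

namespace DAAuction

variable {n : ℕ} (D : DAAuction n) (Feas : Finset (Finset (Fin n)))
  (F : Fin n → ProbabilityMeasure ℝ≥0)

theorem exists_standing_eq_virtualPrice (ω : (D.virtualPricing F).Seed)
    (h : List (Finset (Fin n))) (i : Fin n) :
    ∃ r, (D.virtualPricing F).standing ω h i = virtualPrice (F i) r := by
  cases h with
  | nil => exact ⟨0, (virtualPrice_zero _).symm⟩
  | cons A h => exact ⟨D.price ω A h i, rfl⟩

/-- The ironed virtual surplus of the winners in the state `s`, at the values `v`. -/
def virtualSurplus (v : Fin n → ℝ≥0) (s : Finset (Fin n) × List (Finset (Fin n))) : ℝ≥0∞ :=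
  ∑ i ∈ s.1, (virtualValue (F i) (v i) : ℝ≥0∞)

/-- The winners' utility at their standing prices in the state `s`, at the values `v`. -/
def utility (ω : D.Seed) (v : Fin n → ℝ≥0) (s : Finset (Fin n) × List (Finset (Fin n))) :
    ℝ≥0∞ :=
  ∑ i ∈ s.1, ((v i : ℝ≥0∞) - D.standing ω s.2 i)

theorem measurableSet_reach_left (ω : D.Seed) (A : Finset (Fin n)) (h : List (Finset (Fin n))) :
    MeasurableSet {v | D.Reach Feas ω v A h} :=
  measurable_prodMk_left (x := ω) (D.measurableSet_reach Feas A h)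

open Classical in
theorem lintegral_final (ω : D.Seed)
    {φ : (Fin n → ℝ≥0) → Finset (Fin n) × List (Finset (Fin n)) → ℝ≥0∞}
    (hφ : ∀ s, Measurable fun v => φ v s) (μ : Measure (Fin n → ℝ≥0)) :
    ∫⁻ v, D.final Feas ω v (φ v) ∂μ =
      ∑' s, if s.1 ∈ Feas then ∫⁻ v in {v | D.Reach Feas ω v s.1 s.2}, φ v s ∂μ else 0 := by
  have heq : ∀ v, D.final Feas ω v (φ v) = ∑' s : Finset (Fin n) × List (Finset (Fin n)),
      if s.1 ∈ Feas then {v | D.Reach Feas ω v s.1 s.2}.indicator (fun v => φ v s) v else 0 := by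
    intro v
    rw [final_eq_tsum]
    refine tsum_congr fun s => ?_
    by_cases h1 : s.1 ∈ Feas <;> by_cases h2 : D.Reach Feas ω v s.1 s.2 <;> simp [h1, h2]
  simp_rw [heq]
  rw [lintegral_tsum]
  · refine tsum_congr fun s => ?_
    split_ifs
    · rw [lintegral_indicator (D.measurableSet_reach_left Feas ω _ _)]
    · simp
  · intro s
    split_ifs
    · exact ((hφ s).indicator (D.measurableSet_reach_left Feas ω _ _)).aemeasurable
    · exact aemeasurable_const

open Classical in
theorem measurable_final_utility :
    Measurable fun x : D.Seed × (Fin n → ℝ≥0) => D.final Feas x.1 x.2 (D.utility x.1 x.2) := by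
  simp_rw [final_eq_tsum]
  refine Measurable.tsum fun s => ?_
  refine Measurable.ite ((MeasurableSet.const _).inter (D.measurableSet_reach Feas s.1 s.2)) ?_
    measurable_const
  refine Finset.measurable_fun_sum _ fun i _ => ?_
  exact Measurable.sub (by fun_prop) ((D.measurable_standing s.2 i).comp measurable_fst)

variable {F} (hmean : ∀ i, FiniteMean (F i)) (hatom : ∀ i, Atomless (F i))
include hmean hatom

/-- On each history, an active agent's virtual surplus is at most its utility, as it faces a price
at which the two expectations agree. -/
theorem setLIntegral_virtualValue_le_utility (ω : (D.virtualPricing F).Seed)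
    {A : Finset (Fin n)} {h : List (Finset (Fin n))} {i : Fin n} (hi : i ∈ A) :
    ∫⁻ v in {v | (D.virtualPricing F).Reach Feas ω v A h},
        (virtualValue (F i) (v i) : ℝ≥0∞) ∂(productLaw F) ≤
      ∫⁻ v in {v | (D.virtualPricing F).Reach Feas ω v A h},
        ((v i : ℝ≥0∞) - (D.virtualPricing F).standing ω h i) ∂(productLaw F) := by
  obtain ⟨C, hC, hBC⟩ := (D.virtualPricing F).reach_section Feas ω A h hi
  refine setLIntegral_le_of_section F i ((D.virtualPricing F).measurableSet_reach_left Feas ω A h)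
    hC hBC (f := fun y => (virtualValue (F i) y : ℝ≥0∞))
    (g := fun y => (y : ℝ≥0∞) - (D.virtualPricing F).standing ω h i)
    (measurable_virtualValue _).coe_nnreal_ennreal (by fun_prop) ?_
  obtain ⟨r, hr⟩ := D.exists_standing_eq_virtualPrice F ω h i
  rw [hr, virtualValue_eq_lintegral_sub_virtualPrice (hmean i) (hatom i)]
  rw [← lintegral_indicator (measurableSet_le measurable_const (by fun_prop))]
  refine lintegral_mono fun y => ?_
  by_cases hy : virtualPrice (F i) r ≤ y
  · simp [hy]
  · rw [tsub_eq_zero_of_le (not_le.1 hy).le]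
    exact zero_le

/-- For a fixed seed, the expected ironed virtual surplus of the transformed auction is at most the
winners' expected utility. -/
theorem lintegral_final_virtualSurplus_le (ω : (D.virtualPricing F).Seed) :
    ∫⁻ v, (D.virtualPricing F).final Feas ω v (virtualSurplus F v) ∂(productLaw F) ≤
      ∫⁻ v, (D.virtualPricing F).final Feas ω v ((D.virtualPricing F).utility ω v)
        ∂(productLaw F) := by
  classical
  have hw : ∀ i, Measurable fun v : Fin n → ℝ≥0 => (virtualValue (F i) (v i) : ℝ≥0∞) := fun i =>
    ((measurable_virtualValue _).comp (measurable_pi_apply i)).coe_nnreal_ennreal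
  have hr : ∀ (s : List (Finset (Fin n))) (i : Fin n), Measurable fun v : Fin n → ℝ≥0 =>
      (v i : ℝ≥0∞) - (D.virtualPricing F).standing ω s i := fun s i => by fun_prop
  rw [lintegral_final (φ := virtualSurplus F) _ _ _ fun s =>
      Finset.measurable_fun_sum _ fun i _ => hw i,
    lintegral_final (φ := (D.virtualPricing F).utility ω) _ _ _ fun s =>
      Finset.measurable_fun_sum _ fun i _ => hr s.2 i]
  refine ENNReal.tsum_le_tsum fun s => ?_
  split_ifs
  · unfold virtualSurplus utility
    rw [lintegral_finsetSum _ fun i _ => hw i, lintegral_finsetSum _ fun i _ => hr s.2 i]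
    exact Finset.sum_le_sum fun i hi =>
      D.setLIntegral_virtualValue_le_utility Feas hmean hatom ω hi
  · exact le_rfl

/-- Almost surely, the transformed auction at the values runs like the original auction at the
ironed virtual values. -/
theorem ae_run_virtualPricing :
    ∀ᵐ x ∂(D.seedLaw.prod (productLaw F)), ∀ t, (D.virtualPricing F).run Feas x.1 x.2 t =
      D.run Feas x.1 (fun i => virtualValue (F i) (x.2 i)) t := by
  have hprice : ∀ (A : Finset (Fin n)) (h : List (Finset (Fin n))) (i : Fin n),
      ∀ᵐ x ∂(D.seedLaw.prod (productLaw F)),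
        (D.virtualPricing F).price x.1 A h i ≤ x.2 i ↔
          D.price x.1 A h i ≤ virtualValue (F i) (x.2 i) := by
    intro A h i
    have hm1 : MeasurableSet {x : D.Seed × (Fin n → ℝ≥0) |
        (D.virtualPricing F).price x.1 A h i ≤ x.2 i} :=
      measurableSet_le (((D.virtualPricing F).measurable_price A h i).comp measurable_fst)
        (by fun_prop)
    have hm2 : MeasurableSet {x : D.Seed × (Fin n → ℝ≥0) |
        D.price x.1 A h i ≤ virtualValue (F i) (x.2 i)} :=
      measurableSet_le ((D.measurable_price A h i).comp measurable_fst)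
        ((measurable_virtualValue _).comp
          ((measurable_pi_apply i).comp measurable_snd)).coe_nnreal_ennreal
    refine (Measure.ae_prod_iff_ae_ae (hm1.iff hm2)).2 ?_
    refine Filter.Eventually.of_forall fun ω => ?_
    exact (measurePreserving_eval (fun i => (F i : Measure ℝ≥0)) i).quasiMeasurePreserving.ae
      (ae_virtualPrice_le_iff (hmean i) (hatom i) (D.price ω A h i))
  filter_upwards [ae_all_iff.2 fun A => ae_all_iff.2 fun h => ae_all_iff.2 fun i => hprice A h i]
    with x hx t
  induction t with
  | zero => rfl
  | succ t ih =>
    refine ((D.virtualPricing F).run_succ Feas x.1 x.2 t).trans ((congrArg _ ih).trans ?_)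
    rw [run_succ]
    unfold step
    split_ifs
    · rfl
    · congr 1
      ext i
      simp [hx]

omit hmean in
theorem map_seed_virtualValue :
    (D.seedLaw.prod (productLaw F)).map
        (Prod.map id fun v i => virtualValue (F i) (v i)) =
      D.seedLaw.prod (productLaw fun i => ironedLaw (F i)) := by
  rw [← Measure.map_prod_map _ _ measurable_id (measurable_virtualValue_pi F), Measure.map_id,
    map_virtualValue_productLaw F hatom]

/-- The algorithm performs at least as well as the original auction does for the ironed virtual
values. -/
theorem surplus_ironedLaw_le :
    D.surplus Feas (fun i => ironedLaw (F i)) ≤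
      ((D.virtualPricing F).toPenAlg Feas).performance F := by
  calc D.surplus Feas (fun i => ironedLaw (F i))
      ≤ ∫⁻ x, ⨆ t, D.surplusAt Feas x.1 (fun i => virtualValue (F i) (x.2 i)) t
          ∂(D.seedLaw.prod (productLaw F)) := by
        unfold surplus
        rw [← D.map_seed_virtualValue hatom]
        exact lintegral_map_le _ _
    _ = ∫⁻ x, (D.virtualPricing F).final Feas x.1 x.2 (virtualSurplus F x.2)
          ∂(D.seedLaw.prod (productLaw F)) := by
        refine lintegral_congr_ae ?_
        filter_upwards [D.ae_run_virtualPricing Feas hmean hatom] with x hx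
        unfold final surplusAt virtualSurplus
        simp_rw [hx]
    _ ≤ ∫⁻ ω, ∫⁻ v, (D.virtualPricing F).final Feas ω v (virtualSurplus F v)
          ∂(productLaw F) ∂D.seedLaw := lintegral_prod_le _
    _ ≤ ∫⁻ ω, ∫⁻ v, (D.virtualPricing F).final Feas ω v ((D.virtualPricing F).utility ω v)
          ∂(productLaw F) ∂D.seedLaw :=
        lintegral_mono fun ω => D.lintegral_final_virtualSurplus_le Feas hmean hatom ω
    _ = ∫⁻ x, (D.virtualPricing F).final Feas x.1 x.2 ((D.virtualPricing F).utility x.1 x.2)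
          ∂(D.seedLaw.prod (productLaw F)) :=
        (lintegral_prod _ ((D.virtualPricing F).measurable_final_utility Feas).aemeasurable).symm
    _ ≤ ((D.virtualPricing F).toPenAlg Feas).performance F :=
        lintegral_mono fun x => (D.virtualPricing F).final_le_payoff

theorem valid_virtualPricing (hD : D.Terminates Feas fun i => ironedLaw (F i)) :
    ((D.virtualPricing F).toPenAlg Feas).Valid Feas F := by
  unfold Terminates at hD
  rw [← D.map_seed_virtualValue hatom] at hD
  have hD' := ae_of_ae_map
    (measurable_id.prodMap (measurable_virtualValue_pi F)).aemeasurable hD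
  have hrun := D.ae_run_virtualPricing Feas hmean hatom
  change ∀ᵐ x ∂(D.seedLaw.prod (productLaw F)), _
  filter_upwards [hD', hrun] with x ⟨t, ht⟩ hx
  have ht' : ((D.virtualPricing F).run Feas x.1 x.2 t).1 ∈ Feas := by
    rw [hx t]; exact ht
  obtain ⟨τ, hτ, -⟩ := (D.virtualPricing F).exists_output ht'
  exact ⟨τ, _, ht', hτ⟩

end DAAuction

/-! ### Consumer surplus of incentive compatible mechanisms -/

section SingleAgent

/-- The envelope formula: if a function has subgradients `x` in `[0, 1]`, its increments are
integrals of `x`. -/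
theorem envelope {x : ℝ≥0 → ℝ} (hx : Monotone x) (hx0 : ∀ a, 0 ≤ x a) (hx1 : ∀ a, x a ≤ 1)
    {u : ℝ≥0 → ℝ} (hu : ∀ a b : ℝ≥0, u b + ((a : ℝ) - b) * x b ≤ u a) (b : ℝ≥0) :
    ENNReal.ofReal (u b - u 0) ≤ ∫⁻ t in Ioc 0 (b : ℝ), ENNReal.ofReal (x t.toNNReal) := by
  set y : ℝ → ℝ := fun t => x t.toNNReal with hy
  set f : ℝ → ℝ := fun t => u t.toNNReal with hf
  have hym : Monotone y := fun s t hst => hx (Real.toNNReal_mono hst)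
  have hsub : ∀ s t : ℝ, 0 ≤ s → 0 ≤ t → f t + (s - t) * y t ≤ f s := fun s t hs ht => by
    simpa [hs, ht] using hu s.toNNReal t.toNNReal
  have hcont : ContinuousOn f (Icc 0 b) := by
    have : LipschitzOnWith 1 f (Icc 0 (b : ℝ)) := by
      refine LipschitzOnWith.of_le_add fun s hs t ht => ?_
      have h1 := hsub t s ht.1 hs.1
      have h2 : (s - t) * y s ≤ dist s t := by
        rw [Real.dist_eq]
        calc (s - t) * y s ≤ |s - t| * y s :=
              mul_le_mul_of_nonneg_right (le_abs_self _) (hx0 _)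
          _ ≤ |s - t| * 1 := mul_le_mul_of_nonneg_left (hx1 _) (abs_nonneg _)
          _ = _ := mul_one _
      linarith
    exact this.continuousOn
  have hder : ∀ t ∈ Ioo 0 (b : ℝ) \ {t | ¬ ContinuousAt y t}, HasDerivAt f (y t) t := by
    rintro t ⟨ht, htc⟩
    have htc : ContinuousAt y t := not_not.1 htc
    rw [hasDerivAt_iff_isLittleO, Asymptotics.isLittleO_iff]
    intro c hc
    -- the increment lies between `(s - t) * y t` and `(s - t) * y s`
    filter_upwards [Metric.continuousAt_iff'.1 htc c hc, Ioi_mem_nhds ht.1] with s hs hs0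
    have h1 := hsub s t (le_of_lt hs0) ht.1.le
    have h2 := hsub t s ht.1.le (le_of_lt hs0)
    rw [Real.dist_eq] at hs
    rw [smul_eq_mul, Real.norm_eq_abs, Real.norm_eq_abs, abs_of_nonneg (by linarith)]
    calc f s - f t - (s - t) * y t ≤ (s - t) * (y s - y t) := by linarith
      _ ≤ |s - t| * |y s - y t| := by rw [← abs_mul]; exact le_abs_self _
      _ ≤ |s - t| * c := mul_le_mul_of_nonneg_left hs.le (abs_nonneg _)
      _ = c * |s - t| := mul_comm _ _
  have hint : IntervalIntegrable y volume 0 b := hym.intervalIntegrable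
  have hftc := integral_eq_of_hasDerivAt_off_countable_of_le f y b.coe_nonneg
    hym.countable_not_continuousAt hcont hder hint
  rw [intervalIntegral.integral_of_le b.coe_nonneg] at hftc
  have hfb : f b - f 0 = u b - u 0 := by simp [hf]
  rw [← hfb, ← hftc, ofReal_integral_eq_lintegral_ofReal
    ((intervalIntegrable_iff_integrableOn_Ioc_of_le b.coe_nonneg).1 hint)
    (Filter.Eventually.of_forall fun t => hx0 _)]

theorem lintegral_Ioc_indicator_Iic {x : ℝ} (hx1 : x ≤ 1) (k : ℝ≥0∞) :
    ∫⁻ s in Ioc (0 : ℝ) 1, (Iic x).indicator (fun _ => k) s = k * ENNReal.ofReal x := by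
  rw [lintegral_indicator_const measurableSet_Iic, Measure.restrict_apply measurableSet_Iic]
  have : Iic x ∩ Ioc 0 1 = Ioc 0 x := by
    ext s; simp only [mem_inter_iff, mem_Iic, mem_Ioc]
    exact ⟨fun h => ⟨h.2.1, h.1⟩, fun h => ⟨h.2, h.1, h.2.trans hx1⟩⟩
  rw [this, Real.volume_Ioc, sub_zero]

variable {F : ProbabilityMeasure ℝ≥0} (hmean : FiniteMean F) (hatom : Atomless F)
include hmean hatom

/-- A monotone allocation rule is a mixture of posted prices, each of which yields a utility of at
most the ironed virtual value of those who accept it. -/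
theorem lintegral_envelope_le {x : ℝ≥0 → ℝ} (hx : Monotone x)
    (hx1 : ∀ a, x a ≤ 1) :
    ∫⁻ b : ℝ≥0, (∫⁻ t in Ioc 0 (b : ℝ), ENNReal.ofReal (x t.toNNReal)) ∂(F : Measure ℝ≥0) ≤
      ∫⁻ b, (virtualValue F b : ℝ≥0∞) * ENNReal.ofReal (x b) ∂(F : Measure ℝ≥0) := by
  -- the least value that is served with probability at least `s`
  set c : ℝ → ℝ≥0∞ := fun s => ⨅ (a : ℝ≥0) (_ : s ≤ x a), (a : ℝ≥0∞) with hc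
  have hcm : Monotone c := fun s s' h => le_iInf₂ fun a ha => iInf₂_le a (h.trans ha)
  have hcx : ∀ s a, s ≤ x a → c s ≤ a := fun s a ha => iInf₂_le a ha
  have hxc : ∀ s (a : ℝ≥0), c s < a → s ≤ x a := fun s a ha => by
    obtain ⟨a', ha'⟩ := iInf_lt_iff.1 ha
    obtain ⟨h1, h2⟩ := iInf_lt_iff.1 ha'
    exact h1.trans (hx (ENNReal.coe_lt_coe.1 h2).le)
  have hxm : Measurable x := hx.measurable
  calc ∫⁻ b : ℝ≥0, (∫⁻ t in Ioc 0 (b : ℝ), ENNReal.ofReal (x t.toNNReal)) ∂(F : Measure ℝ≥0)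
      ≤ ∫⁻ b : ℝ≥0, (∫⁻ s in Ioc (0 : ℝ) 1, ((b : ℝ≥0∞) - c s)) ∂(F : Measure ℝ≥0) := by
        refine lintegral_mono fun b => ?_
        have h1 : ∀ t : ℝ, ENNReal.ofReal (x t.toNNReal) =
            ∫⁻ s in Ioc (0 : ℝ) 1, (Iic (x t.toNNReal)).indicator (fun _ => 1) s := fun t => by
          rw [lintegral_Ioc_indicator_Iic (hx1 _), one_mul]
        simp_rw [h1]
        rw [lintegral_lintegral_swap]
        · refine lintegral_mono fun s => ?_
          have h2 : ∀ t : ℝ, (Iic (x t.toNNReal)).indicator (fun _ => (1 : ℝ≥0∞)) s =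
              {t : ℝ | s ≤ x t.toNNReal}.indicator (fun _ => 1) t := fun t => rfl
          have hms : MeasurableSet {t : ℝ | s ≤ x t.toNNReal} :=
            measurableSet_le measurable_const (hxm.comp measurable_real_toNNReal)
          simp_rw [h2]
          rw [lintegral_indicator_const hms, one_mul, Measure.restrict_apply hms]
          rcases eq_or_ne (c s) ∞ with h | h
          · have : {t : ℝ | s ≤ x t.toNNReal} ∩ Ioc 0 b = ∅ := by
              refine eq_empty_of_forall_notMem fun t ht => ?_
              have := hcx s _ ht.1
              simp [h] at this
            rw [this]; simp
          · have hsub : {t : ℝ | s ≤ x t.toNNReal} ∩ Ioc 0 b ⊆ Icc (c s).toReal b := by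
              rintro t ⟨h1, h2⟩
              refine ⟨?_, h2.2⟩
              have := ENNReal.toReal_mono ENNReal.coe_ne_top (hcx s _ h1)
              simpa [h2.1.le] using this
            refine (measure_mono hsub).trans ?_
            rw [Real.volume_Icc, ENNReal.ofReal_sub _ ENNReal.toReal_nonneg,
              ENNReal.ofReal_toReal h, ENNReal.ofReal_coe_nnreal]
        · have hms : MeasurableSet {p : ℝ × ℝ | p.2 ≤ x p.1.toNNReal} :=
            measurableSet_le measurable_snd
              (hxm.comp (measurable_real_toNNReal.comp measurable_fst))
          exact (measurable_const.indicator (f := fun _ => (1 : ℝ≥0∞)) hms).aemeasurable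
    _ = ∫⁻ s in Ioc (0 : ℝ) 1, ∫⁻ b : ℝ≥0, ((b : ℝ≥0∞) - c s) ∂(F : Measure ℝ≥0) := by
        refine lintegral_lintegral_swap ?_
        have := hcm.measurable
        exact Measurable.aemeasurable (by unfold Function.uncurry; fun_prop)
    _ ≤ ∫⁻ s in Ioc (0 : ℝ) 1, ∫⁻ b, {b | s ≤ x b}.indicator
          (fun b => (virtualValue F b : ℝ≥0∞)) b ∂(F : Measure ℝ≥0) := by
        refine lintegral_mono fun s => ?_
        have hms : MeasurableSet {b : ℝ≥0 | s ≤ x b} := measurableSet_le measurable_const hxm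
        rw [lintegral_indicator hms]
        rcases eq_or_ne (c s) ∞ with h | h
        · simp [h]
        · lift c s to ℝ≥0 using h with a ha
          refine (lintegral_sub_le_virtualValue hmean hatom a).trans ?_
          have : NullSingletonClass (F : Measure ℝ≥0) := ⟨hatom⟩
          rw [← setLIntegral_congr (Ioi_ae_eq_Ici (μ := (F : Measure ℝ≥0)) (a := a))]
          refine lintegral_mono_set fun b hb => hxc s b ?_
          rw [← ha]
          exact ENNReal.coe_lt_coe.2 hb
    _ = ∫⁻ b, (∫⁻ s in Ioc (0 : ℝ) 1, {b | s ≤ x b}.indicator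
          (fun b => (virtualValue F b : ℝ≥0∞)) b) ∂(F : Measure ℝ≥0) := by
        refine lintegral_lintegral_swap ?_
        have hms : MeasurableSet {p : ℝ × ℝ≥0 | p.1 ≤ x p.2} :=
          measurableSet_le measurable_fst (hxm.comp measurable_snd)
        exact (Measurable.indicator (f := fun p : ℝ × ℝ≥0 => (virtualValue F p.2 : ℝ≥0∞))
          ((measurable_virtualValue F).comp measurable_snd).coe_nnreal_ennreal hms).aemeasurable
    _ = ∫⁻ b, (virtualValue F b : ℝ≥0∞) * ENNReal.ofReal (x b) ∂(F : Measure ℝ≥0) := by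
        refine lintegral_congr fun b => ?_
        rw [← lintegral_Ioc_indicator_Iic (hx1 b)]
        rfl

/-- The expected utility of an incentive compatible, individually rational interim mechanism is at
most its expected ironed virtual surplus. -/
theorem lintegral_utility_le {X P : ℝ≥0 → ℝ≥0∞} (hX : ∀ a, X a ≤ 1)
    (hIC : ∀ a b : ℝ≥0, (a : ℝ≥0∞) * X b + P a ≤ a * X a + P b)
    (hIR : ∀ a : ℝ≥0, P a ≤ a * X a) :
    ∫⁻ b, ((b : ℝ≥0∞) * X b - P b) ∂(F : Measure ℝ≥0) ≤
      ∫⁻ b, (virtualValue F b : ℝ≥0∞) * X b ∂(F : Measure ℝ≥0) := by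
  have hXt : ∀ a, X a ≠ ∞ := fun a => ne_top_of_le_ne_top ENNReal.one_ne_top (hX a)
  have haX : ∀ a b : ℝ≥0, (a : ℝ≥0∞) * X b ≠ ∞ := fun a b =>
    ENNReal.mul_ne_top ENNReal.coe_ne_top (hXt b)
  have hPt : ∀ a, P a ≠ ∞ := fun a => ne_top_of_le_ne_top (haX a a) (hIR a)
  set x : ℝ≥0 → ℝ := fun a => (X a).toReal with hx
  set u : ℝ≥0 → ℝ := fun a => a * x a - (P a).toReal with hu
  have hIC' : ∀ a b : ℝ≥0, (a : ℝ) * x b + (P a).toReal ≤ a * x a + (P b).toReal := fun a b => by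
    have := ENNReal.toReal_mono (ENNReal.add_ne_top.2 ⟨haX a a, hPt b⟩) (hIC a b)
    simpa [ENNReal.toReal_add, haX, hPt] using this
  have hsub : ∀ a b : ℝ≥0, u b + ((a : ℝ) - b) * x b ≤ u a := fun a b => by
    have := hIC' a b
    simp only [hu]; linarith
  have hmono : Monotone x := fun a b hab => by
    rcases hab.eq_or_lt with rfl | hab
    · exact le_rfl
    have h1 := hsub a b
    have h2 := hsub b a
    have h3 : (0 : ℝ) < (b : ℝ) - a := sub_pos.2 (NNReal.coe_lt_coe.2 hab)
    nlinarith
  have hx1 : ∀ a, x a ≤ 1 := fun a => ENNReal.toReal_le_of_le_ofReal zero_le_one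
    (by simpa using hX a)
  have hx0 : ∀ a, 0 ≤ x a := fun a => ENNReal.toReal_nonneg
  have hu0 : u 0 = 0 := by
    have : P 0 = 0 := by simpa using hIR 0
    simp [hu, this]
  calc ∫⁻ b, ((b : ℝ≥0∞) * X b - P b) ∂(F : Measure ℝ≥0)
      = ∫⁻ b, ENNReal.ofReal (u b - u 0) ∂(F : Measure ℝ≥0) := by
        refine lintegral_congr fun b => ?_
        rw [hu0, sub_zero]
        simp only [hu, hx]
        rw [ENNReal.ofReal_sub _ ENNReal.toReal_nonneg, ENNReal.ofReal_mul b.coe_nonneg,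
          ENNReal.ofReal_toReal (hXt b), ENNReal.ofReal_toReal (hPt b), ENNReal.ofReal_coe_nnreal]
    _ ≤ ∫⁻ b : ℝ≥0, (∫⁻ t in Ioc 0 (b : ℝ), ENNReal.ofReal (x t.toNNReal)) ∂(F : Measure ℝ≥0) :=
        lintegral_mono fun b => envelope hmono hx0 hx1 hsub b
    _ ≤ ∫⁻ b, (virtualValue F b : ℝ≥0∞) * ENNReal.ofReal (x b) ∂(F : Measure ℝ≥0) :=
        lintegral_envelope_le hmean hatom hmono hx1
    _ = _ := by simp_rw [hx, ENNReal.ofReal_toReal (hXt _)]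

end SingleAgent

namespace Mechanism

variable {n : ℕ} {Feas : Finset (Finset (Fin n))} (M : Mechanism n Feas)
  (F : Fin n → ProbabilityMeasure ℝ≥0)

theorem measurable_serve (i : Fin n) : Measurable (M.serve i) :=
  Finset.measurable_fun_sum _ fun S hS => M.measurable_alloc S (Finset.mem_filter.1 hS).1

theorem serve_le_one (i : Fin n) (v : Fin n → ℝ≥0) : M.serve i v ≤ 1 := by
  rw [← M.alloc_sum v]
  exact Finset.sum_le_sum_of_subset (Finset.filter_subset _ _)

theorem interimServe_le_one (i : Fin n) (b : ℝ≥0) : M.interimServe F i b ≤ 1 := by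
  calc M.interimServe F i b ≤ ∫⁻ _, 1 ∂(productLaw F) :=
        lintegral_mono fun v => ENNReal.coe_le_one_iff.2 (M.serve_le_one i _)
    _ = 1 := by simp

end Mechanism

section

variable {n : ℕ} (F : Fin n → ProbabilityMeasure ℝ≥0)

theorem measurable_lintegral_update (i : Fin n) {g : (Fin n → ℝ≥0) → ℝ≥0∞} (hg : Measurable g) :
    Measurable fun b => ∫⁻ v, g (Function.update v i b) ∂(productLaw F) :=
  Measurable.lintegral_prod_left'
    (f := fun p : (Fin n → ℝ≥0) × ℝ≥0 => g (Function.update p.1 i p.2))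
    (hg.comp measurable_update')

/-- An expectation in terms of the interim expectation of an agent. -/
theorem lintegral_mul_eq_interim (i : Fin n) {k : ℝ≥0 → ℝ≥0∞} (hk : Measurable k)
    {g : (Fin n → ℝ≥0) → ℝ≥0∞} (hg : Measurable g) :
    ∫⁻ v, k (v i) * g v ∂(productLaw F) =
      ∫⁻ b, k b * ∫⁻ v, g (Function.update v i b) ∂(productLaw F) ∂(F i : Measure ℝ≥0) := by
  have hup : Measurable fun p : (Fin n → ℝ≥0) × ℝ≥0 => Function.update p.1 i p.2 :=
    measurable_update'
  rw [lintegral_productLaw_update F i (f := fun v => k (v i) * g v)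
    ((hk.comp (measurable_pi_apply i)).mul hg)]
  simp_rw [Function.update_self]
  rw [lintegral_lintegral_swap]
  · refine lintegral_congr fun b => ?_
    exact lintegral_const_mul _ (hg.comp (hup.comp (measurable_id.prodMk measurable_const)))
  · exact ((hk.comp measurable_snd).mul (hg.comp hup)).aemeasurable

variable {F} (hmean : ∀ i, FiniteMean (F i)) (hatom : ∀ i, Atomless (F i))
  {Feas : Finset (Finset (Fin n))}
include hmean hatom

/-- Payments are subtracted agent by agent at the interim level, where utility is bounded by virtual
surplus. -/
theorem Mechanism.consumerSurplus_le (M : Mechanism n Feas) (hIC : M.IsBIC F) (hIR : M.IsIR F) :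
    M.consumerSurplus F ≤ optSurplus Feas fun i => ironedLaw (F i) := by
  have hs : ∀ i, Measurable fun v => (M.serve i v : ℝ≥0∞) := fun i =>
    (M.measurable_serve i).coe_nnreal_ennreal
  have hp : ∀ i, Measurable fun v => (M.pay i v : ℝ≥0∞) := fun i =>
    (M.measurable_pay i).coe_nnreal_ennreal
  have hw : ∀ i, Measurable fun x => (virtualValue (F i) x : ℝ≥0∞) := fun i =>
    (measurable_virtualValue (F i)).coe_nnreal_ennreal
  have hi : ∀ i, ∫⁻ v, (v i : ℝ≥0∞) * (M.serve i v : ℝ≥0∞) ∂(productLaw F) ≤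
      ∫⁻ v, (virtualValue (F i) (v i) : ℝ≥0∞) * (M.serve i v : ℝ≥0∞) ∂(productLaw F) +
        ∫⁻ v, (M.pay i v : ℝ≥0∞) ∂(productLaw F) := by
    intro i
    have h1 := lintegral_mul_eq_interim F i (k := fun _ => 1) measurable_const (hp i)
    simp only [one_mul] at h1
    rw [lintegral_mul_eq_interim F i (k := fun b => (b : ℝ≥0∞)) (by fun_prop) (hs i),
      lintegral_mul_eq_interim F i (hw i) (hs i), h1]
    have h2 := lintegral_utility_le (hmean i) (hatom i) (M.interimServe_le_one F i) (hIC i) (hIR i)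
    refine le_trans ?_ (add_le_add_left h2 _)
    rw [← lintegral_add_right _ (measurable_lintegral_update F i (hp i))]
    exact lintegral_mono fun b => le_tsub_add
  have hpt : ∀ v : Fin n → ℝ≥0,
      ∑ i, (virtualValue (F i) (v i) : ℝ≥0∞) * (M.serve i v : ℝ≥0∞) ≤
        Feas.sup fun S => ∑ i ∈ S, (virtualValue (F i) (v i) : ℝ≥0∞) := by
    intro v
    set W := fun S : Finset (Fin n) => ∑ i ∈ S, (virtualValue (F i) (v i) : ℝ≥0∞) with hW
    calc ∑ i, (virtualValue (F i) (v i) : ℝ≥0∞) * (M.serve i v : ℝ≥0∞)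
        = ∑ S ∈ Feas, (M.alloc v S : ℝ≥0∞) * W S := by
          simp only [Mechanism.serve, hW, ENNReal.ofNNReal_finsetSum, Finset.sum_filter,
            Finset.mul_sum]
          rw [Finset.sum_comm]
          refine Finset.sum_congr rfl fun S _ => ?_
          rw [← Finset.sum_subset (Finset.subset_univ S) fun i _ hi => by simp [hi]]
          exact Finset.sum_congr rfl fun i hi => by rw [if_pos hi, mul_comm]
      _ ≤ ∑ S ∈ Feas, (M.alloc v S : ℝ≥0∞) * Feas.sup W :=
          Finset.sum_le_sum fun S hS => mul_le_mul_right (Finset.le_sup hS) _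
      _ = Feas.sup W := by
          rw [← Finset.sum_mul, ← ENNReal.ofNNReal_finsetSum, M.alloc_sum, ENNReal.coe_one, one_mul]
  rw [optSurplus_ironedLaw F Feas hatom]
  unfold Mechanism.consumerSurplus
  have hvs : ∀ i, Measurable fun v : Fin n → ℝ≥0 => (v i : ℝ≥0∞) * (M.serve i v : ℝ≥0∞) :=
    fun i => (measurable_pi_apply i).coe_nnreal_ennreal.mul (hs i)
  have hws : ∀ i, Measurable fun v : Fin n → ℝ≥0 =>
      (virtualValue (F i) (v i) : ℝ≥0∞) * (M.serve i v : ℝ≥0∞) :=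
    fun i => ((hw i).comp (measurable_pi_apply i)).mul (hs i)
  rw [tsub_le_iff_right, lintegral_finsetSum _ fun i _ => hp i,
    lintegral_finsetSum _ fun i _ => hvs i]
  refine (Finset.sum_le_sum fun i _ => hi i).trans ?_
  rw [Finset.sum_add_distrib]
  refine add_le_add_left ?_ _
  rw [← lintegral_finsetSum _ fun i _ => hws i]
  exact lintegral_mono hpt

theorem optConsumerSurplus_le :
    optConsumerSurplus Feas F ≤ optSurplus Feas fun i => ironedLaw (F i) :=
  iSup₂_le fun M hM => M.consumerSurplus_le hmean hatom hM.1 hM.2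

end

/-! ### The approximation ratios -/

section

theorem lintegral_virtualValue_ne_top {F : ProbabilityMeasure ℝ≥0} (hmean : FiniteMean F)
    (hatom : Atomless F) : ∫⁻ x, (virtualValue F x : ℝ≥0∞) ∂(F : Measure ℝ≥0) ≠ ∞ := by
  have h := setLIntegral_virtualValue_quantile hmean hatom (right_mem_Icc.2 zero_le_one)
  have huniv : {x | quantile F x ≤ 1} = univ := eq_univ_of_forall fun x => (quantile_mem_Icc F x).2
  rw [huniv, setLIntegral_univ] at h
  rw [h]
  exact ENNReal.ofReal_ne_top

theorem finiteMean_ironedLaw {F : ProbabilityMeasure ℝ≥0} (hmean : FiniteMean F)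
    (hatom : Atomless F) : FiniteMean (ironedLaw F) := by
  unfold FiniteMean
  rw [← map_virtualValue hatom, lintegral_map (by fun_prop) (measurable_virtualValue F)]
  exact lintegral_virtualValue_ne_top hmean hatom

variable {n : ℕ} (Feas : Finset (Finset (Fin n))) {F : Fin n → ProbabilityMeasure ℝ≥0}

theorem lintegral_coordinate (F : Fin n → ProbabilityMeasure ℝ≥0) (i : Fin n) {k : ℝ≥0 → ℝ≥0∞}
    (hk : Measurable k) :
    ∫⁻ v, k (v i) ∂(productLaw F) = ∫⁻ x, k x ∂(F i : Measure ℝ≥0) :=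
  (measurePreserving_eval (fun i => (F i : Measure ℝ≥0)) i).lintegral_comp hk

theorem sum_le_optSurplus (F : Fin n → ProbabilityMeasure ℝ≥0) {S : Finset (Fin n)}
    (hS : S ∈ Feas) : ∑ i ∈ S, ∫⁻ x, (x : ℝ≥0∞) ∂(F i : Measure ℝ≥0) ≤ optSurplus Feas F := by
  simp_rw [← lintegral_coordinate F _ (k := fun x => (x : ℝ≥0∞)) (by fun_prop)]
  rw [← lintegral_finsetSum _ fun i _ => by fun_prop]
  exact lintegral_mono fun v => Finset.le_sup (f := fun S => ∑ i ∈ S, (v i : ℝ≥0∞)) hS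

theorem optSurplus_le_sum (F : Fin n → ProbabilityMeasure ℝ≥0) :
    optSurplus Feas F ≤ ∑ S ∈ Feas, ∑ i ∈ S, ∫⁻ x, (x : ℝ≥0∞) ∂(F i : Measure ℝ≥0) := by
  simp_rw [← lintegral_coordinate F _ (k := fun x => (x : ℝ≥0∞)) (by fun_prop)]
  simp_rw [← lintegral_finsetSum (μ := productLaw F) _
    fun (i : Fin n) (_ : i ∈ _) => (measurable_pi_apply (X := fun _ => ℝ≥0) i).coe_nnreal_ennreal]
  rw [← lintegral_finsetSum _ fun S _ => by fun_prop]
  refine lintegral_mono fun v => Finset.sup_le fun S hS => ?_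
  exact Finset.single_le_sum (f := fun S => ∑ i ∈ S, (v i : ℝ≥0∞)) (fun _ _ => zero_le) hS

theorem optSurplus_ne_top (hmean : ∀ i, FiniteMean (F i)) : optSurplus Feas F ≠ ∞ :=
  ne_top_of_le_ne_top (ENNReal.sum_ne_top.2 fun _ _ => ENNReal.sum_ne_top.2 fun i _ => hmean i)
    (optSurplus_le_sum Feas F)

theorem lintegral_le_lintegral_ironedLaw {F : ProbabilityMeasure ℝ≥0} (hmean : FiniteMean F)
    (hatom : Atomless F) :
    ∫⁻ x, (x : ℝ≥0∞) ∂(F : Measure ℝ≥0) ≤ ∫⁻ x, (x : ℝ≥0∞) ∂(ironedLaw F : Measure ℝ≥0) := by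
  rw [← map_virtualValue hatom, lintegral_map (by fun_prop) (measurable_virtualValue F)]
  have h := lintegral_sub_le_virtualValue hmean hatom 0
  simpa using h.trans (setLIntegral_le_lintegral _ _)

/-- If the optimal surplus of the ironed virtual values vanishes, so does that of the values. -/
theorem optSurplus_eq_zero_of_ironedLaw (hmean : ∀ i, FiniteMean (F i))
    (hatom : ∀ i, Atomless (F i)) (h : optSurplus Feas (fun i => ironedLaw (F i)) = 0) :
    optSurplus Feas F = 0 := by
  refine le_antisymm ((optSurplus_le_sum Feas F).trans (Finset.sum_nonpos fun S hS => ?_)) zero_le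
  rw [← h]
  exact (Finset.sum_le_sum fun i _ =>
    lintegral_le_lintegral_ironedLaw (hmean i) (hatom i)).trans (sum_le_optSurplus Feas _ hS)

end

end PenTesting

end

theorem theorem1 (n : ℕ) (Feas : Finset (Finset (Fin n)))
    (DA : (Fin n → ProbabilityMeasure ℝ≥0) → PenTesting.DAAuction n)
    (hDA : ∀ G : Fin n → ProbabilityMeasure ℝ≥0, (∀ i, PenTesting.FiniteMean (G i)) →
      (DA G).Terminates Feas G)
    (F : Fin n → ProbabilityMeasure ℝ≥0)
    (hmean : ∀ i, PenTesting.FiniteMean (F i))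
    (hatom : ∀ i, PenTesting.Atomless (F i))
    (alg : PenTesting.PenAlg n)
    (halg : alg =
      ((DA fun i => PenTesting.ironedLaw (F i)).virtualPricing F).toPenAlg Feas) :
    alg.Valid Feas F ∧
    PenTesting.standardBenchmark Feas F / alg.performance F ≤
      PenTesting.standardApprox Feas DA ∧
    PenTesting.optSurplus Feas F / alg.performance F ≤
      PenTesting.standardApprox Feas DA * PenTesting.omniscientApprox Feas := by
  subst halg
  set G := fun i => PenTesting.ironedLaw (F i) with hG
  set D := DA G with hD
  set p := ((D.virtualPricing F).toPenAlg Feas).performance F with hp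
  set a := PenTesting.optSurplus Feas F with ha
  set g := PenTesting.optSurplus Feas G with hg
  have hGmean : ∀ i, PenTesting.FiniteMean (G i) := fun i =>
    PenTesting.finiteMean_ironedLaw (hmean i) (hatom i)
  have hγ : g / p ≤ PenTesting.standardApprox Feas DA :=
    (ENNReal.div_le_div_left (D.surplus_ironedLaw_le Feas hmean hatom) g).trans
      (le_iSup₂_of_le G hGmean le_rfl)
  have hζ : a / g ≤ PenTesting.omniscientApprox Feas :=
    -- the optimal consumer surplus for `F` is at most `g`
    (ENNReal.div_le_div_left (PenTesting.optConsumerSurplus_le hmean hatom) a).trans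
      (le_iSup₂_of_le F (fun i => ⟨hmean i, hatom i⟩) le_rfl)
  refine ⟨D.valid_virtualPricing Feas hmean hatom (hDA G hGmean), ?_, ?_⟩
  · exact (ENNReal.div_le_div_right (PenTesting.standardBenchmark_le hmean hatom Feas) p).trans hγ
  · rcases eq_or_ne g 0 with h0 | h0
    · rw [ha, PenTesting.optSurplus_eq_zero_of_ironedLaw Feas hmean hatom h0, ENNReal.zero_div]
      exact zero_le
    -- the ratio is `(g / p) * (a / g)`
    · refine le_trans (le_of_eq ?_) (mul_le_mul' hγ hζ)
      have hgt : g ≠ ∞ := PenTesting.optSurplus_ne_top Feas hGmean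
      rw [div_eq_mul_inv, div_eq_mul_inv, div_eq_mul_inv]
      calc a * p⁻¹ = (g * g⁻¹) * (a * p⁻¹) := by rw [ENNReal.mul_inv_cancel h0 hgt, one_mul]
        _ = g * p⁻¹ * (a * g⁻¹) := by ring
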